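/- Identify a non-vertical line in $\mathbb{R}^2$ with the pair $(y_-,y_+)$ of the heights at which it meets the lines $x=-1$ and $x=+1$. Let $\Pi_\infty$ be the improper anisotropic Poisson line process, that is, a Poisson process of non-vertical lines with intensity measure $\mathrm{d}\nu=\tfrac14\,\mathrm{d}y_-\,\mathrm{d}y_+$. Let $\Pi_{\infty,+}$ be the set of lines of $\Pi_\infty$ that have positive slope and meet the negative $x$-axis, and define the seminal curve $$\Gamma(s)=\inf\{\text{height of }\ell\text{ at }x=s:\ \ell\in\Pi_{\infty,+}\}\qquad(0<s\le 1).$$ Let $\Gamma'(s)$ denote its left derivative. A slope change is a point of $(0,1)$ at which $\Gamma$ is not differentiable. Put $S_0=1$, let $S_{n+1}$ be the supremum of the slope changes that are less than $S_n$, and put $Y_n=\Gamma(S_n)-S_n\Gamma'(S_n)$. A line of $\Pi_{\infty,+}$ is a component of $\Gamma$ if $\Gamma$ coincides with it on some nondegenerate interval contained in $(0,1]$. **Theorem.** Almost surely: 1. $1=S_0>S_1>S_2>\dots>0$, and $\{S_1,S_2,\dots\}$ is the set of all slope changes of $\Gamma$ in $(0,1)$. 2. The components of $\Gamma$ can be enumerated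 as $\ell_0,\ell_1,\ell_2,\dots$ in strictly increasing order of their heights at $x=1$. For every $n$, $\Gamma'(s)$ exists and equals the slope of $\ell_n$ for $S_n\ge s>S_{n+1}$, and $Y_n>0$ is the intercept of $\ell_n$ on the $y$-axis. Moreover there are random variables $E_1,E_2,\dots$ with the standard exponential distribution and $U_1,U_2,\dots$ with the uniform distribution on $[0,1]$, defined on the same probability space, such that almost surely, for all $n\ge0$, $$\frac1{S_{n+1}}=\frac1{S_n}+\frac{4}{Y_n^2}\,E_{n+1},\qquad \Gamma'(S_{n+1})=\Gamma'(S_n)+\frac{Y_n}{S_{n+1}}\sqrt{U_{n+1}}.$$ The variables $E_1,U_1,E_2,U_2,\dots$ are mutually independent, and this family is independent of the pair $(\Gamma(1),\Gamma'(1))$. The pair has joint density $\tfrac12e^{-\gamma^2/4}$ on $\{(\gamma,g):0<g<\gamma\}$; that is, $\mathbb{P}(\Gamma(1)>\gamma)=e^{-\gamma^2/4}$ for $\gamma>0$ and, given $\Gamma(1)$, $\Gamma'(1)$ is uniform on $[0,\Gamma(1)]$. -/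

import Mathlib

open MeasureTheory ProbabilityTheory Set
open scoped ENNReal

noncomputable section

namespace PoissonCity

/-- The number (possibly `⊤`) of points of the random set `P` which lie in `B`. -/
def count {Ω X : Type*} (P : Ω → Set X) (B : Set X) (ω : Ω) : ℕ∞ := (P ω ∩ B).encard

/-- A (simple) Poisson point process on `X` with intensity measure `ν`: a random set of points
whose counts are random variables, such that the count of a set of finite intensity has the Poisson
distribution with that mean, and counts of disjoint sets are independent. -/
structure IsPoissonProcess {Ω X : Type*} [MeasurableSpace Ω] [MeasurableSpace X]
    (P : Ω → Set X) (ν : Measure X) (μ : Measure Ω) : Prop where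
  measurable_count : ∀ B : Set X, MeasurableSet B → Measurable (count P B)
  hasLaw_count : ∀ B : Set X, MeasurableSet B → ν B ≠ ∞ →
    HasLaw (count P B)
      ((poissonMeasure (ν B).toNNReal).map (fun k : ℕ => (k : ℕ∞))) μ
  indep_count : ∀ (m : ℕ) (B : Fin m → Set X), (∀ i, MeasurableSet (B i)) →
    Pairwise (fun i j => Disjoint (B i) (B j)) → iIndepFun (fun i => count P (B i)) μ

/-- A non-vertical line in the plane, given by the pair `(y₋, y₊)` of the heights at which it meets
the vertical lines `x = -1` and `x = 1`. -/
abbrev Line : Type := ℝ × ℝ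

/-- The slope of a line. -/
def Line.slope (l : Line) : ℝ := (l.2 - l.1) / 2

/-- The height at which the line meets the vertical line with abscissa `x`. -/
def Line.height (l : Line) (x : ℝ) : ℝ := l.1 + l.slope * (x + 1)

/-- The intensity measure `dy₋ dy₊ / 4` of the improper anisotropic Poisson line process. -/
def lineIntensity : Measure Line := (4⁻¹ : ℝ≥0∞) • volume

/-- Those lines of a line pattern that have positive slope and meet the negative `x`-axis. -/
def positiveLines (L : Set Line) : Set Line :=
  {l ∈ L | 0 < l.slope ∧ ∃ x < 0, l.height x = 0}

/-- The seminal curve `Γ = Γ₊` of a line pattern: the lower envelope of the lines of positive slope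
that meet the negative `x`-axis. -/
def seminal (L : Set Line) (s : ℝ) : ℝ :=
  sInf ((fun l : Line => l.height s) '' positiveLines L)

/-- The derivative `Γ'` of the seminal curve, in its left-continuous version: the left derivative
of `Γ`. -/
def seminalSlope (L : Set Line) (s : ℝ) : ℝ := derivWithin (seminal L) (Iio s) s

/-- The times in `(0, 1)` at which the seminal curve changes slope. -/
def slopeChanges (L : Set Line) : Set ℝ :=
  {s ∈ Ioo (0 : ℝ) 1 | ¬ DifferentiableAt ℝ (seminal L) s}

/-- The successive times of change of slope in reversed time: `S₀ = 1`, and `Sₙ₊₁` is the last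
time before `Sₙ` at which the seminal curve changes slope. -/
def changeTime (L : Set Line) : ℕ → ℝ
  | 0 => 1
  | n + 1 => sSup {s ∈ slopeChanges L | s < changeTime L n}

/-- `Yₙ = Γ(Sₙ) - Sₙ Γ'(Sₙ)`. -/
def yIntercept (L : Set Line) (n : ℕ) : ℝ :=
  seminal L (changeTime L n) - changeTime L n * seminalSlope L (changeTime L n)

/-- The lines which are components of the seminal curve over `(0, 1]`: those with which the curve
coincides along a nondegenerate interval. -/
def components (L : Set Line) : Set Line :=
  {l ∈ positiveLines L | ∃ a b : ℝ, 0 < a ∧ a < b ∧ b ≤ 1 ∧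
    ∀ s ∈ Icc a b, seminal L s = l.height s}

/-- `l₀, l₁, l₂, …` enumerates the components of the seminal curve in increasing order of their
heights on `x = 1`. -/
def IsTangentEnumeration (L : Set Line) (l : ℕ → Line) : Prop :=
  range l = components L ∧ StrictMono (fun n => (l n).height 1)

/-- The distribution of `(Γ(1), Γ'(1))`, with density `exp(-γ²/4)/2` over `0 < g < γ`. The first
coordinate is Rayleigh, `P(Γ(1) > γ) = exp(-γ²/4)`; given the first, the second is uniform on
`[0, γ]`. -/
def initialLaw : Measure (ℝ × ℝ) :=
  volume.withDensity ({p : ℝ × ℝ | 0 < p.2 ∧ p.2 < p.1}.indicator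
    fun p => ENNReal.ofReal (Real.exp (-p.1 ^ 2 / 4) / 2))

end PoissonCity

end

open PoissonCity

/-!
In the coordinates `(c, g)`, intercept and slope, the lines of positive slope which meet the
negative axis are the points of the open quadrant, the intensity is half of Lebesgue measure, and
the seminal curve is `Γ(s) = inf (c + g s)`. Its components are the vertices of the lower convex
hull of the points, seen from the directions `(1, s)`, `0 < s ≤ 1`.

*Shape of the curve.* Almost surely only finitely many points lie in any bounded set, and there are
points of arbitrarily small intercept (`ae_regular`). For such patterns (`Regular`) everything is
deterministic: over `[a, 1]` only finitely many lines matter, the line followed to the left of `s`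
is the steepest among the lowest ones at `s` (`IsLead`), and it is given up at a positive time for a
steeper line (`IsLead.exists_next`). This yields the change times, their accumulation at `0` only,
and the enumeration of the components.

*Law of the lead lines.* Let `x = (x₀, …, xₙ)` be a convex chain. If there is exactly one point in a
small ball about each `xᵢ`, and there is no other point below the chains close to `x`, then the first
lead lines are those points (`Regular.coord_leadLine_mem`). The independence of the Poisson counts
evaluates the probability of this event, so that the joint law of the lead lines has, by the
differentiation theorem for measures, at least the density `2⁻⁽ⁿ⁺¹⁾ exp (-m)`, where `m` is the
intensity of the region below the chain (`ae_chainDens_le_rnDeriv`). That region is the triangle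
below the first line at time `1`, together with the triangles swept when the supporting line rotates
about the vertices, of intensities `cᵢ² / 4 * (1 / Sᵢ₊₁ - 1 / Sᵢ)`. The candidate density therefore
factorises into transition densities, and in each transition the intensity `E` of the swept triangle
and the squared relative position `U` of the new point on the supporting line are independent,
exponential and uniform (`lintegral_transDens`). In particular the candidate has total mass `1`, so
the lower bound is an equality (`map_leadCoords_eq`). No strong Markov property of the Poisson
process is needed.

The independence of all the variables follows from that of finitely many.
-/

namespace PoissonCity

open Filter Topology

/-! ### The lower envelope of a regular line pattern -/

lemma Line.height_eq (l : Line) (x : ℝ) : l.height x = l.height 0 + l.slope * x := by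
  simp only [Line.height]; ring

lemma Line.ext_height_slope {l m : Line} (h : l.height 0 = m.height 0)
    (h' : l.slope = m.slope) : l = m := by
  simp only [Line.height, Line.slope] at h h'
  ext <;> linarith

lemma Line.ext_two_heights {l m : Line} {s t : ℝ} (hst : s ≠ t) (hs : l.height s = m.height s)
    (ht : l.height t = m.height t) : l = m := by
  rw [l.height_eq, m.height_eq] at hs ht
  have h : l.slope = m.slope := by
    have : (l.slope - m.slope) * (s - t) = 0 := by linarith
    rcases mul_eq_zero.1 this with h | h
    · linarith
    · exact absurd (sub_eq_zero.1 h) hst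
  refine Line.ext_height_slope ?_ h
  rw [h] at hs; linarith

lemma mem_positiveLines {L : Set Line} {l : Line} :
    l ∈ positiveLines L ↔ l ∈ L ∧ 0 < l.slope ∧ 0 < l.height 0 := by
  simp only [positiveLines, mem_ofPred_eq]
  refine and_congr_right fun _ => and_congr_right fun hs => ⟨?_, fun h => ?_⟩
  · rintro ⟨x, hx, h⟩
    rw [l.height_eq] at h
    nlinarith
  · refine ⟨-(l.height 0 / l.slope), by have := div_pos h hs; linarith, ?_⟩
    rw [l.height_eq]; field_simp; ring

lemma slope_pos {L : Set Line} {l : Line} (h : l ∈ positiveLines L) : 0 < l.slope :=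
  (mem_positiveLines.1 h).2.1

lemma height_zero_pos {L : Set Line} {l : Line} (h : l ∈ positiveLines L) : 0 < l.height 0 :=
  (mem_positiveLines.1 h).2.2

lemma height_pos {L : Set Line} {l : Line} (h : l ∈ positiveLines L) {s : ℝ} (hs : 0 ≤ s) :
    0 < l.height s := by
  rw [l.height_eq]
  have := height_zero_pos h
  have := mul_nonneg (slope_pos h).le hs
  linarith

lemma seminal_le {L : Set Line} {l : Line} (h : l ∈ positiveLines L) {s : ℝ} (hs : 0 ≤ s) :
    seminal L s ≤ l.height s :=
  csInf_le ⟨0, by rintro _ ⟨m, hm, rfl⟩; exact (height_pos hm hs).le⟩ ⟨l, h, rfl⟩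

/-- The properties of a line pattern from which the shape of its seminal curve follows: its
positive lines of bounded intercept and slope are finite in number, and some of them have
arbitrarily small intercept. -/
structure Regular (L : Set Line) : Prop where
  finite : ∀ r : ℝ, {l ∈ positiveLines L | l.height 0 ≤ r ∧ l.slope ≤ r}.Finite
  small : ∀ ε : ℝ, 0 < ε → ∃ l ∈ positiveLines L, l.height 0 < ε

/-- `l` is the line followed by the seminal curve immediately to the left of `s`: among the
positive lines of least height at `s`, the steepest one. -/
structure IsLead (L : Set Line) (s : ℝ) (l : Line) : Prop where
  mem : l ∈ positiveLines L
  le : ∀ m ∈ positiveLines L, l.height s ≤ m.height s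
  steep : ∀ m ∈ positiveLines L, m.height s = l.height s → m.slope ≤ l.slope

lemma seminal_eq_of_le {L : Set Line} {l : Line} {s : ℝ} (h : l ∈ positiveLines L)
    (hs : 0 ≤ s) (hle : ∀ m ∈ positiveLines L, l.height s ≤ m.height s) :
    seminal L s = l.height s := by
  refine le_antisymm (seminal_le h hs) (le_csInf ⟨_, l, h, rfl⟩ ?_)
  rintro _ ⟨m, hm, rfl⟩
  exact hle m hm

lemma IsLead.seminal_eq {L : Set Line} {l : Line} {s : ℝ} (h : IsLead L s l) (hs : 0 ≤ s) :
    seminal L s = l.height s := seminal_eq_of_le h.mem hs h.le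

lemma IsLead.unique {L : Set Line} {l m : Line} {s : ℝ} (hl : IsLead L s l)
    (hm : IsLead L s m) : l = m := by
  have h1 : l.height s = m.height s := le_antisymm (hl.le m hm.mem) (hm.le l hl.mem)
  have h2 : l.slope = m.slope := le_antisymm (hm.steep l hl.mem h1) (hl.steep m hm.mem h1.symm)
  refine Line.ext_height_slope ?_ h2
  rw [l.height_eq, m.height_eq, h2] at h1; linarith

/-- Only finitely many positive lines pass below a given height over `[a, ∞)`, `a > 0`. -/
lemma Regular.finite_low {L : Set Line} (hL : Regular L) {a : ℝ} (ha : 0 < a) (C : ℝ) :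
    {l ∈ positiveLines L | ∃ s, a ≤ s ∧ l.height s ≤ C}.Finite := by
  refine (hL.finite (max C (C / a))).subset ?_
  rintro l ⟨hl, s, has, hs⟩
  have h0 := height_zero_pos hl
  have h1 := slope_pos hl
  rw [l.height_eq] at hs
  refine ⟨hl, le_max_of_le_left ?_, le_max_of_le_right ?_⟩
  · nlinarith
  · rw [le_div_iff₀ ha]; nlinarith

lemma Regular.exists_lead {L : Set Line} (hL : Regular L) {s : ℝ} (hs : 0 < s) :
    ∃ l, IsLead L s l := by
  obtain ⟨m₀, hm₀, -⟩ := hL.small 1 one_pos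
  obtain ⟨l, ⟨hl, -⟩, hmin⟩ := Set.exists_min_image _
    (fun l : Line => toLex (l.height s, -l.slope)) (hL.finite_low hs (m₀.height s))
    ⟨m₀, hm₀, s, le_rfl, le_rfl⟩
  have key : ∀ m ∈ positiveLines L, m.height s ≤ m₀.height s →
      l.height s < m.height s ∨ l.height s = m.height s ∧ m.slope ≤ l.slope := by
    intro m hm h
    simpa [Prod.Lex.toLex_le_toLex] using hmin m ⟨hm, s, le_rfl, h⟩
  have hle : ∀ m ∈ positiveLines L, l.height s ≤ m.height s := by
    intro m hm
    rcases le_total (m.height s) (m₀.height s) with h | h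
    · rcases key m hm h with h | h
      · exact h.le
      · exact h.1.le
    · rcases key m₀ hm₀ le_rfl with h' | h'
      · exact (h'.trans_le h).le
      · exact h'.1.le.trans h
  refine ⟨l, hl, hle, fun m hm h => ?_⟩
  rcases key m hm (h.le.trans (hle m₀ hm₀)) with h' | h'
  · exact absurd h h'.ne'
  · exact h'.2

/-- A line of least height at both ends of an interval is the lower envelope over the interval,
because the difference to any other line is affine. -/
lemma seminal_eq_between {L : Set Line} {l : Line} {t s u : ℝ} (hl : l ∈ positiveLines L)
    (ht : 0 ≤ t) (h1 : ∀ m ∈ positiveLines L, l.height t ≤ m.height t)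
    (h2 : ∀ m ∈ positiveLines L, l.height s ≤ m.height s) (hu : u ∈ Icc t s) :
    seminal L u = l.height u := by
  refine seminal_eq_of_le hl (ht.trans hu.1) fun m hm => ?_
  have a := h1 m hm
  have b := h2 m hm
  rw [l.height_eq, m.height_eq] at a b ⊢
  rcases le_total l.slope m.slope with h | h
  · nlinarith [hu.1]
  · nlinarith [hu.2]

/-- The touching time and the line at which the lead line `l` of time `s` is given up. -/
lemma IsLead.exists_next {L : Set Line} (hL : Regular L) {s : ℝ} (hs : 0 < s) {l : Line}
    (hl : IsLead L s l) :
    ∃ t m, 0 < t ∧ t < s ∧ IsLead L t m ∧ l.slope < m.slope ∧ l.height t = m.height t := by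
  -- candidates: a positive line of smaller intercept is steeper and crosses `l` at a positive time
  have steep : ∀ m ∈ positiveLines L, m.height 0 < l.height 0 → l.slope < m.slope := by
    intro m hm h
    have := hl.le m hm
    rw [l.height_eq, m.height_eq] at this
    by_contra! h'
    nlinarith
  set T : Line → ℝ := fun m => (l.height 0 - m.height 0) / (m.slope - l.slope) with hT
  have hTh : ∀ m, l.slope < m.slope → l.height (T m) = m.height (T m) := by
    intro m hm
    have : m.slope - l.slope ≠ 0 := (sub_pos.2 hm).ne'
    rw [l.height_eq, m.height_eq, hT]; field_simp; ring
  obtain ⟨m₁, hm₁, h₁⟩ := hL.small _ (height_zero_pos hl.mem)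
  have hT₁ : 0 < T m₁ := div_pos (sub_pos.2 h₁) (sub_pos.2 (steep m₁ hm₁ h₁))
  have hfin : {m ∈ positiveLines L | m.height 0 < l.height 0 ∧ T m₁ ≤ T m}.Finite := by
    refine (hL.finite (max (l.height 0) (l.slope + l.height 0 / T m₁))).subset ?_
    rintro m ⟨hm, h, hTm⟩
    refine ⟨hm, le_max_of_le_left h.le, le_max_of_le_right ?_⟩
    have h' := sub_pos.2 (steep m hm h)
    rw [hT, le_div_iff₀ h'] at hTm
    have := height_zero_pos hm
    have : m.slope - l.slope ≤ l.height 0 / T m₁ := by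
      rw [le_div_iff₀ hT₁]; linarith
    linarith
  obtain ⟨m₂, ⟨hm₂, h₂, h₂₁⟩, hmax⟩ := Set.exists_max_image _ T hfin ⟨m₁, hm₁, h₁, le_rfl⟩
  have hT₂ : 0 < T m₂ := hT₁.trans_le h₂₁
  have hs₂ := steep m₂ hm₂ h₂
  have hts : T m₂ < s := by
    by_contra! h
    have e := hTh m₂ hs₂
    have a := hl.le m₂ hm₂
    have e' : m₂.height s = l.height s := by
      rw [l.height_eq, m₂.height_eq] at *
      nlinarith
    exact absurd (hl.steep m₂ hm₂ e') (not_le.2 hs₂)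
  have htouch : ∀ m ∈ positiveLines L, l.height (T m₂) ≤ m.height (T m₂) := by
    intro m hm
    by_contra! h
    have a := hl.le m hm
    have hsl : l.slope < m.slope := by
      rw [l.height_eq, m.height_eq] at *
      by_contra! h'
      nlinarith
    have h0 : m.height 0 < l.height 0 := by
      rw [l.height_eq, m.height_eq] at h
      nlinarith
    have hlt : T m₂ < T m := by
      rw [hT]; simp only
      rw [lt_div_iff₀ (sub_pos.2 hsl)]
      rw [l.height_eq, m.height_eq] at h
      simp only [hT] at h
      linarith
    exact absurd (hmax m ⟨hm, h0, h₂₁.trans hlt.le⟩) (not_le.2 hlt)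
  obtain ⟨m, hm⟩ := hL.exists_lead hT₂
  have e : l.height (T m₂) = m.height (T m₂) :=
    le_antisymm (htouch m hm.mem) (hm.le l hl.mem)
  refine ⟨T m₂, m, hT₂, hts, hm, hs₂.trans_le (hm.steep m₂ hm₂ ?_), e⟩
  rw [← e, hTh m₂ hs₂]

lemma Line.hasDerivAt_height (l : Line) (s : ℝ) : HasDerivAt l.height l.slope s := by
  have : l.height = fun x => l.height 0 + l.slope * x := funext l.height_eq
  rw [this]
  simpa using ((hasDerivAt_id s).const_mul l.slope).const_add (l.height 0)

/-- At an interior time where two lines of different slopes touch the envelope, it has a kink. -/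
lemma not_differentiableAt_of_touch {L : Set Line} {l m : Line} {t : ℝ} (ht : 0 < t)
    (hl : l ∈ positiveLines L) (hm : m ∈ positiveLines L) (hlt : seminal L t = l.height t)
    (hmt : seminal L t = m.height t) (h : l.slope ≠ m.slope) :
    ¬ DifferentiableAt ℝ (seminal L) t := by
  intro hd
  have key : ∀ k ∈ positiveLines L, seminal L t = k.height t → k.slope = deriv (seminal L) t := by
    intro k hk hkt
    have h1 := (k.hasDerivAt_height t).sub hd.hasDerivAt
    have hmin : IsLocalMin (k.height - seminal L) t := by
      filter_upwards [lt_mem_nhds ht] with u hu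
      simp only [Pi.sub_apply, hkt, sub_self]
      exact sub_nonneg.2 (seminal_le hk hu.le)
    exact sub_eq_zero.1 (hmin.hasDerivAt_eq_zero h1)
  exact h ((key l hl hlt).trans (key m hm hmt).symm)

lemma differentiableAt_of_eqOn {L : Set Line} {l : Line} {t s u : ℝ}
    (h : ∀ u ∈ Icc t s, seminal L u = l.height u) (hu : u ∈ Ioo t s) :
    DifferentiableAt ℝ (seminal L) u := by
  have : seminal L =ᶠ[𝓝 u] l.height := by
    filter_upwards [Ioo_mem_nhds hu.1 hu.2] with v hv using h v (Ioo_subset_Icc_self hv)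
  exact this.differentiableAt_iff.2 (l.hasDerivAt_height u).differentiableAt

lemma hasDerivWithinAt_of_eqOn {L : Set Line} {l : Line} {t s u : ℝ}
    (h : ∀ u ∈ Icc t s, seminal L u = l.height u) (hu : u ∈ Ioc t s) :
    HasDerivWithinAt (seminal L) l.slope (Iio u) u := by
  refine (l.hasDerivAt_height u).hasDerivWithinAt.congr_of_eventuallyEq ?_ (h u ⟨hu.1.le, hu.2⟩)
  filter_upwards [Ioo_mem_nhdsLT hu.1] with v hv using h v ⟨hv.1.le, hv.2.le.trans hu.2⟩

lemma seminalSlope_of_eqOn {L : Set Line} {l : Line} {t s u : ℝ}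
    (h : ∀ u ∈ Icc t s, seminal L u = l.height u) (hu : u ∈ Ioc t s) :
    seminalSlope L u = l.slope :=
  (hasDerivWithinAt_of_eqOn h hu).derivWithin (uniqueDiffWithinAt_Iio u)

/-- The next change of slope, in reversed time, after a time `s` with lead line `l` is the time
`t` at which a steeper lead line `m` meets `l`. -/
lemma IsLead.isGreatest {L : Set Line} {s t : ℝ} {l m : Line} (hl : IsLead L s l)
    (hm : IsLead L t m) (ht : 0 < t) (hts : t < s) (hs : s ≤ 1) (hlm : l.slope < m.slope)
    (h : l.height t = m.height t) :
    IsGreatest {u ∈ slopeChanges L | u < s} t := by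
  have hlt : ∀ k ∈ positiveLines L, l.height t ≤ k.height t := fun k hk => h ▸ hm.le k hk
  refine ⟨⟨⟨⟨ht, hts.trans_le hs⟩, ?_⟩, hts⟩, fun u hu => ?_⟩
  · exact not_differentiableAt_of_touch ht hl.mem hm.mem (seminal_eq_of_le hl.mem ht.le hlt)
      (hm.seminal_eq ht.le) hlm.ne
  · by_contra! h'
    exact hu.1.2 (differentiableAt_of_eqOn
      (fun v hv => seminal_eq_between hl.mem ht.le hlt hl.le hv) ⟨h', hu.2⟩)

/-- The line with slope `Γ'(Sₙ)` and intercept `Yₙ`, which the seminal curve follows over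
`(Sₙ₊₁, Sₙ]`. -/
noncomputable def leadLine (L : Set Line) (n : ℕ) : Line :=
  (yIntercept L n - seminalSlope L (changeTime L n),
    yIntercept L n + seminalSlope L (changeTime L n))

lemma leadLine_slope (L : Set Line) (n : ℕ) :
    (leadLine L n).slope = seminalSlope L (changeTime L n) := by
  simp only [Line.slope, leadLine]; ring

lemma leadLine_height (L : Set Line) (n : ℕ) : (leadLine L n).height 0 = yIntercept L n := by
  simp only [Line.slope, leadLine, Line.height]; ring

/-- Passing from one change time to the next: the lead line changes from `l` to a steeper one. -/
structure IsStep (L : Set Line) (s : ℝ) (l : Line) (t : ℝ) (m : Line) : Prop where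
  lead : IsLead L s l
  lead' : IsLead L t m
  pos : 0 < t
  lt : t < s
  slope_lt : l.slope < m.slope
  height_eq : l.height t = m.height t

lemma IsStep.eqOn {L : Set Line} {s t : ℝ} {l m : Line} (h : IsStep L s l t m) :
    ∀ u ∈ Icc t s, seminal L u = l.height u := fun _ hu =>
  seminal_eq_between h.lead.mem h.pos.le (fun k hk => h.height_eq ▸ h.lead'.le k hk) h.lead.le hu

lemma IsStep.leadLine_eq {L : Set Line} {n : ℕ} {t : ℝ} {l m : Line}
    (h : IsStep L (changeTime L n) l t m) : leadLine L n = l := by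
  have h1 : seminalSlope L (changeTime L n) = l.slope :=
    seminalSlope_of_eqOn h.eqOn ⟨h.lt, le_rfl⟩
  refine Line.ext_height_slope ?_ ((leadLine_slope L n).trans h1)
  rw [leadLine_height, yIntercept, h1, h.eqOn _ ⟨h.lt.le, le_rfl⟩, l.height_eq]
  ring

lemma IsStep.changeTime_succ {L : Set Line} {n : ℕ} {t : ℝ} {l m : Line}
    (h : IsStep L (changeTime L n) l t m) (h1 : changeTime L n ≤ 1) :
    changeTime L (n + 1) = t :=
  (h.lead.isGreatest h.lead' h.pos h.lt h1 h.slope_lt h.height_eq).csSup_eq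

/-- A regular pattern steps from each change time to the next one. -/
lemma Regular.isStep {L : Set Line} (hL : Regular L) (n : ℕ) :
    0 < changeTime L n ∧ changeTime L n ≤ 1 ∧
      IsStep L (changeTime L n) (leadLine L n) (changeTime L (n + 1)) (leadLine L (n + 1)) := by
  have aux : ∀ n, 0 < changeTime L n → changeTime L n ≤ 1 → ∃ m,
      IsStep L (changeTime L n) (leadLine L n) (changeTime L (n + 1)) m := by
    intro n h0 h1
    obtain ⟨l, hl⟩ := hL.exists_lead h0
    obtain ⟨t, m, a, b, c, d, e⟩ := hl.exists_next hL h0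
    have h : IsStep L (changeTime L n) l t m := ⟨hl, c, a, b, d, e⟩
    rw [h.leadLine_eq, h.changeTime_succ h1]
    exact ⟨m, h⟩
  have pos : ∀ n, 0 < changeTime L n ∧ changeTime L n ≤ 1 := by
    intro n
    induction n with
    | zero => simp [changeTime]
    | succ n ih =>
      obtain ⟨m, hm⟩ := aux n ih.1 ih.2
      exact ⟨hm.pos, hm.lt.le.trans ih.2⟩
  obtain ⟨m, hm⟩ := aux n (pos n).1 (pos n).2
  obtain ⟨m', hm'⟩ := aux (n + 1) (pos (n + 1)).1 (pos (n + 1)).2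
  rw [hm'.lead.unique hm.lead'] at *
  exact ⟨(pos n).1, (pos n).2, hm⟩

lemma Regular.slope_strictMono {L : Set Line} (hL : Regular L) :
    StrictMono fun n => (leadLine L n).slope :=
  strictMono_nat_of_lt_succ fun n => (hL.isStep n).2.2.slope_lt

/-- The change times tend to `0`, since only finitely many lines come into play over `[a, 1]`. -/
lemma Regular.exists_changeTime_lt {L : Set Line} (hL : Regular L) {a : ℝ} (ha : 0 < a) :
    ∃ n, changeTime L n < a := by
  by_contra! h
  obtain ⟨m, hm, -⟩ := hL.small 1 one_pos
  refine Set.infinite_of_injective_forall_mem (f := leadLine L) (fun i j hij => ?_)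
    (fun n => ?_) (hL.finite_low ha (m.height 1))
  · exact hL.slope_strictMono.injective (congrArg Line.slope hij)
  · obtain ⟨h0, h1, hs⟩ := hL.isStep n
    refine ⟨hs.lead.mem, _, h n, (hs.lead.le m hm).trans ?_⟩
    rw [m.height_eq, m.height_eq 1]
    nlinarith [slope_pos hm]

/-- The intervals `(Sₙ₊₁, Sₙ]` cover `(0, 1]`. -/
lemma Regular.exists_mem_Ioc {L : Set Line} (hL : Regular L) {s : ℝ} (hs : s ∈ Ioc (0 : ℝ) 1) :
    ∃ n, s ∈ Ioc (changeTime L (n + 1)) (changeTime L n) := by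
  classical
  have h := hL.exists_changeTime_lt hs.1
  obtain ⟨k, hk⟩ : ∃ k, Nat.find h = k + 1 := by
    refine Nat.exists_eq_succ_of_ne_zero fun h0 => ?_
    have := Nat.find_spec h
    rw [h0] at this
    exact absurd this (not_lt.2 hs.2)
  refine ⟨k, hk ▸ Nat.find_spec h, ?_⟩
  exact not_lt.1 (Nat.find_min h (by omega))

lemma Regular.slopeChanges_eq {L : Set Line} (hL : Regular L) :
    slopeChanges L = range fun n => changeTime L (n + 1) := by
  ext s
  constructor
  · intro hs
    obtain ⟨n, h1, h2⟩ := hL.exists_mem_Ioc (s := s) ⟨hs.1.1, hs.1.2.le⟩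
    have hlt : ¬ s < changeTime L n := fun h =>
      hs.2 (differentiableAt_of_eqOn (hL.isStep n).2.2.eqOn ⟨h1, h⟩)
    have he : s = changeTime L n := le_antisymm h2 (not_lt.1 hlt)
    cases n with
    | zero => exact absurd he hs.1.2.ne
    | succ n => exact ⟨n, he.symm⟩
  · rintro ⟨n, rfl⟩
    obtain ⟨h0, h1, h⟩ := hL.isStep n
    exact (h.lead.isGreatest h.lead' h.pos h.lt h1 h.slope_lt h.height_eq).1.1

lemma Regular.isTangentEnumeration {L : Set Line} (hL : Regular L) :
    IsTangentEnumeration L (leadLine L) := by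
  refine ⟨?_, strictMono_nat_of_lt_succ fun n => ?_⟩
  · ext l
    constructor
    · rintro ⟨n, rfl⟩
      obtain ⟨h0, h1, h⟩ := hL.isStep n
      exact ⟨h.lead.mem, _, _, h.pos, h.lt, h1, h.eqOn⟩
    · rintro ⟨hl, a, b, ha, hab, hb, h⟩
      obtain ⟨n, h1, h2⟩ := hL.exists_mem_Ioc ⟨ha.trans hab, hb⟩
      refine ⟨n, ?_⟩
      have hm : max a (changeTime L (n + 1)) < b := max_lt hab h1
      have e := (hL.isStep n).2.2.eqOn
      refine Line.ext_two_heights hm.ne ?_ ?_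
      · rw [← e _ ⟨le_max_right _ _, hm.le.trans h2⟩, h _ ⟨le_max_left _ _, hm.le⟩]
      · rw [← e _ ⟨h1.le, h2⟩, h _ ⟨hab.le, le_rfl⟩]
  · obtain ⟨h0, h1, h⟩ := hL.isStep n
    have e := h.height_eq
    have := h.slope_lt
    have := h.lt
    rw [Line.height_eq] at e ⊢
    rw [(leadLine L (n + 1)).height_eq] at e
    rw [(leadLine L (n + 1)).height_eq 1]
    nlinarith

/-! ### Recognising the lead lines -/

/-- A finite convex chain of positive lines such that all other positive lines pass strictly above
its corners consists of the first lead lines. -/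
lemma Regular.leadLine_eq_of_chain {L : Set Line} (hL : Regular L) (n : ℕ) (x : ℕ → Line)
    (T : ℕ → ℝ) (hT0 : T 0 = 1) (hT : ∀ i < n, T (i + 1) < T i) (hTpos : ∀ i ≤ n, 0 < T i)
    (hx : ∀ i ≤ n, x i ∈ positiveLines L)
    (hcross : ∀ i < n, (x i).height (T (i + 1)) = (x (i + 1)).height (T (i + 1)))
    (hslope : ∀ i < n, (x i).slope < (x (i + 1)).slope)
    (hother : ∀ m ∈ positiveLines L, (∀ j ≤ n, m ≠ x j) → ∀ i ≤ n,
      (x i).height (T i) < m.height (T i)) :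
    ∀ i ≤ n, leadLine L i = x i ∧ changeTime L i = T i := by
  have hTanti : ∀ k i, i + k ≤ n → T (i + k) ≤ T i := by
    intro k
    induction k with
    | zero => intro i _; exact le_rfl
    | succ k ih =>
      intro i hi
      exact (hT (i + k) (by omega)).le.trans (ih i (by omega))
  -- a later line of the chain passes strictly above the corner of an earlier one
  have later : ∀ k i, i + (k + 1) ≤ n →
      (x i).height (T i) < (x (i + (k + 1))).height (T i) := by
    intro k
    have one : ∀ i j, i ≤ j → j < n → (x j).height (T i) < (x (j + 1)).height (T i) := by
      intro i j hij hj
      have e := hcross j hj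
      have hs := hslope j hj
      have ht : T (j + 1) < T i := by
        obtain ⟨d, rfl⟩ := Nat.exists_eq_add_of_le hij
        exact (hT _ hj).trans_le (hTanti d i (by omega))
      rw [Line.height_eq, (x (j + 1)).height_eq] at e ⊢
      nlinarith
    induction k with
    | zero => intro i hi; exact one i i le_rfl (by omega)
    | succ k ih =>
      intro i hi
      exact (ih i (by omega)).trans (one i (i + (k + 1)) (by omega) (by omega))
  -- an earlier line is flatter, and passes above the corners of the later ones
  have earlier : ∀ k i, i + k ≤ n →
      (x (i + k)).height (T (i + k)) ≤ (x i).height (T (i + k)) ∧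
        (x i).slope ≤ (x (i + k)).slope := by
    intro k
    induction k with
    | zero => intro i _; exact ⟨le_rfl, le_rfl⟩
    | succ k ih =>
      intro i hi
      obtain ⟨h1, h2⟩ := ih i (by omega)
      have e := hcross (i + k) (by omega)
      have hs := hslope (i + k) (by omega)
      have ht := hT (i + k) (by omega)
      rw [← add_assoc]
      refine ⟨?_, h2.trans hs.le⟩
      rw [← e]
      rw [Line.height_eq, (x i).height_eq] at h1 ⊢
      nlinarith
  have lead : ∀ i ≤ n, IsLead L (T i) (x i) := by
    intro i hi
    have key : ∀ m ∈ positiveLines L, (x i).height (T i) < m.height (T i) ∨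
        (x i).height (T i) ≤ m.height (T i) ∧ m.slope ≤ (x i).slope := by
      intro m hm
      by_cases h : ∀ j ≤ n, m ≠ x j
      · exact Or.inl (hother m hm h i hi)
      · push Not at h
        obtain ⟨j, hj, rfl⟩ := h
        rcases lt_or_ge i j with h | h
        · obtain ⟨d, rfl⟩ := Nat.exists_eq_add_of_lt h
          exact Or.inl (later d i hj)
        · obtain ⟨d, rfl⟩ := Nat.exists_eq_add_of_le h
          exact Or.inr (earlier d j hi)
    refine ⟨hx i hi, fun m hm => ?_, fun m hm h => ?_⟩
    · rcases key m hm with h | h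
      · exact h.le
      · exact h.1
    · rcases key m hm with h' | h'
      · exact absurd h h'.ne'
      · exact h'.2
  have time : ∀ i ≤ n, changeTime L i = T i := by
    intro i
    induction i with
    | zero => intro _; rw [hT0]; rfl
    | succ i ih =>
      intro hi
      have h := ih (by omega)
      have hstep : IsStep L (changeTime L i) (x i) (T (i + 1)) (x (i + 1)) :=
        ⟨h ▸ lead i (by omega), lead (i + 1) hi, hTpos _ hi, h ▸ hT i hi, hslope i hi,
          hcross i hi⟩
      exact hstep.changeTime_succ (hL.isStep i).2.1
  exact fun i hi => ⟨((hL.isStep i).2.2.lead).unique (time i hi ▸ lead i hi), time i hi⟩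

/-! ### Poisson point processes -/

section PoissonProcess

variable {Ω X Y : Type*} [MeasurableSpace Ω] [MeasurableSpace X] [MeasurableSpace Y]
  {μ : Measure Ω} {P : Ω → Set X} {ν : Measure X}

lemma IsPoissonProcess.map (h : IsPoissonProcess P ν μ) (e : X ≃ᵐ Y) :
    IsPoissonProcess (fun ω => e '' P ω) (ν.map e) μ := by
  have hc : ∀ B, count (fun ω => e '' P ω) B = count P (e ⁻¹' B) := by
    intro B
    ext1 ω
    rw [count, count, ← image_inter_preimage, e.injective.encard_image]
  refine ⟨fun B hB => ?_, fun B hB hν => ?_, fun m B hB hd => ?_⟩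
  · rw [hc]; exact h.measurable_count _ (e.measurable hB)
  · rw [e.map_apply] at hν ⊢
    rw [hc]; exact h.hasLaw_count _ (e.measurable hB) hν
  · simp_rw [hc]
    exact h.indep_count m _ (fun i => e.measurable (hB i)) fun i j hij => (hd hij).preimage _

lemma IsPoissonProcess.measure_count_eq (h : IsPoissonProcess P ν μ) {B : Set X}
    (hB : MeasurableSet B) (hν : ν B ≠ ∞) (k : ℕ) :
    μ (count P B ⁻¹' {(k : ℕ∞)}) = poissonMeasure (ν B).toNNReal {k} := by
  have hl := h.hasLaw_count B hB hν
  rw [← Measure.map_apply (h.measurable_count B hB) (measurableSet_singleton _), hl.map_eq,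
    Measure.map_apply .of_discrete (measurableSet_singleton _)]
  congr 1
  ext j; simp

lemma IsPoissonProcess.measure_count_eq_zero (h : IsPoissonProcess P ν μ) {B : Set X}
    (hB : MeasurableSet B) (hν : ν B ≠ ∞) :
    μ (count P B ⁻¹' {0}) = ENNReal.ofReal (Real.exp (-(ν B).toReal)) := by
  have := h.measure_count_eq hB hν 0
  rw [poissonMeasure_singleton] at this
  simpa [ENNReal.coe_toNNReal_eq_toReal] using this

lemma IsPoissonProcess.measure_count_eq_one (h : IsPoissonProcess P ν μ) {B : Set X}
    (hB : MeasurableSet B) (hν : ν B ≠ ∞) :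
    μ (count P B ⁻¹' {1}) = ENNReal.ofReal (Real.exp (-(ν B).toReal)) * ν B := by
  have := h.measure_count_eq hB hν 1
  rw [poissonMeasure_singleton] at this
  rw [← Nat.cast_one, this]
  simp only [pow_one, Nat.factorial_one, Nat.cast_one, div_one]
  rw [ENNReal.ofReal_mul (Real.exp_nonneg _), ENNReal.coe_toNNReal_eq_toReal,
    ENNReal.ofReal_toReal hν]

lemma IsPoissonProcess.ae_finite (h : IsPoissonProcess P ν μ) {B : Set X}
    (hB : MeasurableSet B) (hν : ν B ≠ ∞) : ∀ᵐ ω ∂μ, (P ω ∩ B).Finite := by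
  have hl := h.hasLaw_count B hB hν
  have : ∀ᵐ k ∂((poissonMeasure (ν B).toNNReal).map (fun k : ℕ => (k : ℕ∞))), k ≠ ⊤ := by
    refine (ae_map_iff .of_discrete (measurableSet_singleton _).compl).2 ?_
    exact ae_of_all _ fun k => ENat.natCast_ne_top k
  rw [← hl.map_eq] at this
  filter_upwards [ae_of_ae_map hl.aemeasurable this] with ω hω
  exact Set.encard_ne_top_iff.1 hω

lemma count_eq_zero_iff {Ω X : Type*} {P : Ω → Set X} {B : Set X} {ω : Ω} : count P B ω = 0 ↔ P ω ∩ B = ∅ :=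
  Set.encard_eq_zero

/-- A Poisson process charges every set which contains sets of arbitrarily large finite
intensity. -/
lemma IsPoissonProcess.ae_nonempty (h : IsPoissonProcess P ν μ) {B : Set X} {A : ℕ → Set X}
    (hA : ∀ k, MeasurableSet (A k)) (hAB : ∀ k, A k ⊆ B) (hfin : ∀ k, ν (A k) ≠ ∞)
    (hlim : Tendsto (fun k => (ν (A k)).toReal) atTop atTop) :
    ∀ᵐ ω ∂μ, (P ω ∩ B).Nonempty := by
  have h1 : ∀ k, μ {ω | ¬ (P ω ∩ B).Nonempty} ≤ ENNReal.ofReal (Real.exp (-(ν (A k)).toReal)) := by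
    intro k
    rw [← h.measure_count_eq_zero (hA k) (hfin k)]
    refine measure_mono fun ω hω => count_eq_zero_iff.2 ?_
    exact subset_empty_iff.1
      ((inter_subset_inter_right _ (hAB k)).trans (not_nonempty_iff_eq_empty.1 hω).subset)
  have h2 : Tendsto (fun k => ENNReal.ofReal (Real.exp (-(ν (A k)).toReal))) atTop (𝓝 0) := by
    rw [← ENNReal.ofReal_zero]
    exact ENNReal.tendsto_ofReal
      (Real.tendsto_exp_atBot.comp (tendsto_neg_atTop_atBot.comp hlim))
  exact ae_iff.2 (le_antisymm (ge_of_tendsto' h2 h1) bot_le)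

end PoissonProcess

/-! ### Intercept and slope as coordinates -/

/-- The coordinates `(intercept, slope)` of a line. -/
noncomputable def coord : Line ≃ᵐ ℝ × ℝ where
  toFun l := (l.height 0, l.slope)
  invFun p := (p.1 - p.2, p.1 + p.2)
  left_inv l := by
    ext
    · simp [Line.height, Line.slope]
    · simp only [Line.height, Line.slope]; ring
  right_inv p := by ext <;> simp [Line.height, Line.slope]
  measurable_toFun := by
    simp only [Line.height, Line.slope, Equiv.coe_fn_mk]; fun_prop
  measurable_invFun := by simp only [Equiv.coe_fn_symm_mk]; fun_prop

lemma coord_apply (l : Line) : coord l = (l.height 0, l.slope) := rfl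

lemma coord_symm_apply (p : ℝ × ℝ) : coord.symm p = (p.1 - p.2, p.1 + p.2) := rfl

@[simp] lemma coord_symm_slope (p : ℝ × ℝ) : Line.slope (coord.symm p) = p.2 :=
  congrArg Prod.snd (coord.apply_symm_apply p)

@[simp] lemma coord_symm_height_zero (p : ℝ × ℝ) : Line.height (coord.symm p) 0 = p.1 :=
  congrArg Prod.fst (coord.apply_symm_apply p)

lemma coord_symm_height (p : ℝ × ℝ) (s : ℝ) : Line.height (coord.symm p) s = p.1 + p.2 * s := by
  rw [Line.height_eq]; simp

/-- In the coordinates `(intercept, slope)` the intensity is half of Lebesgue measure. -/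
lemma map_coord_lineIntensity :
    lineIntensity.map coord = (2⁻¹ : ℝ≥0∞) • (volume : Measure (ℝ × ℝ)) := by
  let f : ℝ × ℝ →ₗ[ℝ] ℝ × ℝ :=
    Matrix.toLin (Module.Basis.finTwoProd ℝ) (Module.Basis.finTwoProd ℝ) !![1, -1; 1, 1]
  have hf : LinearMap.det f = 2 := by
    simp only [f, LinearMap.det_toLin, Matrix.det_fin_two_of]; norm_num
  have hfc : ⇑f = coord.symm := by
    ext1 p
    rw [coord_symm_apply, Matrix.toLin_finTwoProd_apply]
    ext <;> simp; ring
  ext B hB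
  rw [coord.map_apply, lineIntensity, Measure.smul_apply, Measure.smul_apply]
  have : coord ⁻¹' B = f '' B := by
    rw [hfc]
    exact (coord.toEquiv.symm.image_eq_preimage_symm B).symm
  rw [this, Measure.addHaar_image_linearMap, hf, smul_eq_mul, smul_eq_mul, ← mul_assoc]
  congr 1
  rw [abs_of_pos two_pos, ENNReal.ofReal_ofNat, show (4 : ℝ≥0∞) = 2 * 2 by norm_num,
    ENNReal.mul_inv (by simp) (by simp), mul_assoc,
    ENNReal.inv_mul_cancel (by simp) (by simp), mul_one]

/-- The intensity of the line process in the coordinates `(intercept, slope)`. -/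
noncomputable def intensity : Measure (ℝ × ℝ) := (2⁻¹ : ℝ≥0∞) • volume

lemma intensity_apply (B : Set (ℝ × ℝ)) : intensity B = 2⁻¹ * volume B := rfl

lemma intensity_ne_top {B : Set (ℝ × ℝ)} (h : volume B ≠ ∞) : intensity B ≠ ∞ :=
  ENNReal.mul_ne_top (by simp) h

/-- The coordinates of the lines of positive slope and positive intercept. -/
def quadrant : Set (ℝ × ℝ) := Ioi 0 ×ˢ Ioi 0

lemma isOpen_quadrant : IsOpen quadrant := isOpen_Ioi.prod isOpen_Ioi

lemma mem_quadrant {p : ℝ × ℝ} : p ∈ quadrant ↔ 0 < p.1 ∧ 0 < p.2 := Iff.rfl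

lemma coord_symm_mem_positiveLines {L : Set Line} {p : ℝ × ℝ} :
    coord.symm p ∈ positiveLines L ↔ p ∈ coord '' L ∩ quadrant := by
  rw [mem_positiveLines, coord_symm_slope, coord_symm_height_zero, mem_inter_iff, mem_quadrant]
  have : p ∈ coord '' L ↔ coord.symm p ∈ L := by
    rw [show coord '' L = coord.symm ⁻¹' L from coord.toEquiv.image_eq_preimage_symm L]; rfl
  rw [this]; tauto

section

variable {Ω : Type*} [MeasurableSpace Ω] {μ : Measure Ω} {L : Ω → Set Line}

lemma IsPoissonProcess.coord (hL : IsPoissonProcess L lineIntensity μ) :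
    IsPoissonProcess (fun ω => coord '' L ω) intensity μ := by
  have := hL.map PoissonCity.coord
  rwa [map_coord_lineIntensity] at this

lemma ae_regular (hL : IsPoissonProcess L lineIntensity μ) : ∀ᵐ ω ∂μ, Regular (L ω) := by
  have hP := hL.coord
  have h1 : ∀ᵐ ω ∂μ, ∀ n : ℕ,
      (PoissonCity.coord '' L ω ∩ (Icc 0 (n : ℝ) ×ˢ Icc 0 (n : ℝ))).Finite := by
    refine ae_all_iff.2 fun n => hP.ae_finite (measurableSet_Icc.prod measurableSet_Icc)
      (intensity_ne_top (isCompact_Icc.prod isCompact_Icc).measure_lt_top.ne)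
  have h2 : ∀ᵐ ω ∂μ, ∀ n : ℕ,
      (PoissonCity.coord '' L ω ∩ (Ioo 0 (1 / (n + 1 : ℝ)) ×ˢ Ioi (0 : ℝ))).Nonempty := by
    refine ae_all_iff.2 fun n => ?_
    have hv : ∀ k : ℕ, intensity (Ioo 0 (1 / (n + 1 : ℝ)) ×ˢ Ioo (0 : ℝ) k) =
        ENNReal.ofReal (2⁻¹ * (1 / (n + 1)) * k) := by
      intro k
      have : (0 : ℝ) ≤ 1 / (n + 1) := by positivity
      rw [intensity_apply, Measure.volume_eq_prod, Measure.prod_prod, Real.volume_Ioo,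
        Real.volume_Ioo, sub_zero, sub_zero, ← ENNReal.ofReal_mul this, mul_assoc,
        ENNReal.ofReal_mul (p := 2⁻¹) (by norm_num), ENNReal.ofReal_inv_of_pos two_pos,
        ENNReal.ofReal_ofNat]
    refine hP.ae_nonempty (A := fun k : ℕ => Ioo 0 (1 / (n + 1 : ℝ)) ×ˢ Ioo (0 : ℝ) k)
      (fun k => measurableSet_Ioo.prod measurableSet_Ioo)
      (fun k => prod_mono le_rfl Ioo_subset_Ioi_self) (fun k => ?_) ?_
    · rw [hv]; exact ENNReal.ofReal_ne_top
    · have : ∀ k : ℕ, (intensity (Ioo 0 (1 / (n + 1 : ℝ)) ×ˢ Ioo (0 : ℝ) k)).toReal =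
          2⁻¹ * (1 / (n + 1)) * k := fun k => by
        rw [hv, ENNReal.toReal_ofReal (by positivity)]
      simp_rw [this]
      exact tendsto_natCast_atTop_atTop.const_mul_atTop (by positivity)
  filter_upwards [h1, h2] with ω h1 h2
  refine ⟨fun r => ?_, fun ε hε => ?_⟩
  · obtain ⟨n, hn⟩ := exists_nat_ge r
    refine ((h1 n).preimage PoissonCity.coord.injective.injOn).subset ?_
    rintro l ⟨hl, ha, hb⟩
    exact ⟨⟨l, (mem_positiveLines.1 hl).1, rfl⟩,
      ⟨(height_zero_pos hl).le, ha.trans hn⟩, ⟨(slope_pos hl).le, hb.trans hn⟩⟩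
  · obtain ⟨n, hn⟩ := exists_nat_one_div_lt hε
    obtain ⟨p, hp, h, h'⟩ := h2 n
    refine ⟨PoissonCity.coord.symm p, coord_symm_mem_positiveLines.2 ⟨hp, h.1, h'⟩, ?_⟩
    rw [coord_symm_height_zero]
    exact h.2.trans hn

end

/-! ### Measurability of the lead lines -/

section

variable {Ω : Type*} [MeasurableSpace Ω] {μ : Measure Ω} {L : Ω → Set Line}

lemma aemeasurable_of_nullMeasurableSet_lt {f : Ω → ℝ}
    (h : ∀ a, NullMeasurableSet {ω | f ω < a} μ) : AEMeasurable f μ := by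
  have : NullMeasurable f μ := 
    measurable_of_Iio (δ := NullMeasurableSpace Ω μ) (f := f) h
  exact this.aemeasurable_of_aerange (t := univ) (by simp)

lemma aemeasurable_seminal (hL : IsPoissonProcess L lineIntensity μ) {s : ℝ} (hs : 0 < s) :
    AEMeasurable (fun ω => seminal (L ω) s) μ := by
  refine aemeasurable_of_nullMeasurableSet_lt fun a => ?_
  set B : Set (ℝ × ℝ) := quadrant ∩ {p | p.1 + p.2 * s < a}
  have hB : MeasurableSet B := isOpen_quadrant.measurableSet.inter
    (measurableSet_lt (by fun_prop) (by fun_prop))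
  have hm : MeasurableSet (count (fun ω => coord '' L ω) B ⁻¹' {0})ᶜ :=
    (hL.coord.measurable_count B hB (measurableSet_singleton 0)).compl
  refine hm.nullMeasurableSet.congr ?_
  refine eventuallyEq_set.2 ?_
  filter_upwards [ae_regular hL] with ω hω
  obtain ⟨l, hl, -⟩ := hω.small 1 one_pos
  have hbdd : BddBelow ((fun l : Line => l.height s) '' positiveLines (L ω)) :=
    ⟨0, by rintro _ ⟨m, hm, rfl⟩; exact (height_pos hm hs.le).le⟩
  change ¬ count (fun ω => coord '' L ω) B ω = 0 ↔ seminal (L ω) s < a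
  rw [count_eq_zero_iff, ← ne_eq, ← nonempty_iff_ne_empty, seminal,
    csInf_lt_iff hbdd ⟨_, l, hl, rfl⟩]
  constructor
  · rintro ⟨p, hp, hq, hlt⟩
    refine ⟨_, ⟨coord.symm p, coord_symm_mem_positiveLines.2 ⟨hp, hq⟩, rfl⟩, ?_⟩
    simpa only [coord_symm_height, mem_ofPred_eq] using hlt
  · rintro ⟨_, ⟨m, hm, rfl⟩, hlt⟩
    have := coord_symm_mem_positiveLines.1 ((coord.symm_apply_apply m).symm ▸ hm)
    refine ⟨coord m, this.1, this.2, ?_⟩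
    rw [mem_ofPred_eq, ← coord_symm_height, coord.symm_apply_apply]
    exact hlt

lemma Regular.yIntercept_succ {L : Set Line} (hL : Regular L) (n : ℕ) :
    yIntercept L (n + 1) = yIntercept L n + seminalSlope L (changeTime L n) *
      changeTime L (n + 1) - changeTime L (n + 1) * seminalSlope L (changeTime L (n + 1)) := by
  have h := (hL.isStep n).2.2.height_eq
  rw [Line.height_eq, (leadLine L (n + 1)).height_eq] at h
  simp only [leadLine_height, leadLine_slope] at h
  linarith

lemma Regular.lead_slope_lt_iff {L : Set Line} (hL : Regular L) (n : ℕ) (a : ℝ) :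
    seminalSlope L (changeTime L n) < a ↔ ∃ q r : ℚ, (0 < r ∧ r < q) ∧ (q : ℝ) < changeTime L n ∧
      seminal L q - seminal L r < a * (q - r) := by
  obtain ⟨h0, h1, h⟩ := hL.isStep n
  rw [← leadLine_slope]
  constructor
  · intro ha
    obtain ⟨r, hr, hr'⟩ := exists_rat_btwn h.lt
    obtain ⟨q, hq, hq'⟩ := exists_rat_btwn hr'
    refine ⟨q, r, ⟨by exact_mod_cast h.pos.trans hr, by exact_mod_cast hq⟩, hq', ?_⟩
    rw [h.eqOn q ⟨(hr.trans hq).le, hq'.le⟩, h.eqOn r ⟨hr.le, hr'.le⟩, Line.height_eq,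
      Line.height_eq _ (r : ℝ)]
    nlinarith
  · rintro ⟨q, r, ⟨hr, hrq⟩, hq, hlt⟩
    have hr' : (0 : ℝ) < r := by exact_mod_cast hr
    have hrq' : (r : ℝ) < q := by exact_mod_cast hrq
    obtain ⟨m, hm⟩ := hL.exists_lead (hr'.trans hrq')
    have e1 := hm.seminal_eq (hr'.trans hrq').le
    have e2 := seminal_le hm.mem hr'.le
    have e3 := hm.le _ h.lead.mem
    have e4 := h.lead.le _ hm.mem
    rw [m.height_eq q, (leadLine L n).height_eq q] at e3
    rw [m.height_eq (changeTime L n), (leadLine L n).height_eq (changeTime L n)] at e4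
    rw [m.height_eq] at e1 e2
    have hms : (leadLine L n).slope ≤ m.slope := by
      by_contra! hc
      nlinarith
    by_contra! hc
    nlinarith

lemma Regular.changeTime_succ_lt_iff {L : Set Line} (hL : Regular L) (n : ℕ) (t : ℝ) :
    changeTime L (n + 1) < t ↔ ∃ q : ℚ, (0 < q ∧ (q : ℝ) < t) ∧
      seminal L q = yIntercept L n + seminalSlope L (changeTime L n) * q := by
  obtain ⟨h0, h1, h⟩ := hL.isStep n
  constructor
  · intro ht
    obtain ⟨q, hq, hq'⟩ := exists_rat_btwn (lt_min ht h.lt)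
    rw [lt_min_iff] at hq'
    refine ⟨q, ⟨by exact_mod_cast h.pos.trans hq, hq'.1⟩, ?_⟩
    rw [h.eqOn q ⟨hq.le, hq'.2.le⟩, Line.height_eq, leadLine_height, leadLine_slope]
  · rintro ⟨q, ⟨hq, hqt⟩, he⟩
    refine lt_of_le_of_lt ?_ hqt
    by_contra! hlt
    have hq' : (0 : ℝ) < q := by exact_mod_cast hq
    have e := seminal_le h.lead'.mem hq'.le
    have e' := h.height_eq
    have hs := h.slope_lt
    rw [he, ← leadLine_height, ← leadLine_slope] at e
    rw [(leadLine L (n + 1)).height_eq q] at e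
    rw [Line.height_eq, (leadLine L (n + 1)).height_eq (changeTime L (n + 1))] at e'
    nlinarith

lemma aemeasurable_lead (hL : IsPoissonProcess L lineIntensity μ) (n : ℕ) :
    AEMeasurable (fun ω => changeTime (L ω) n) μ ∧
      AEMeasurable (fun ω => seminalSlope (L ω) (changeTime (L ω) n)) μ ∧
      AEMeasurable (fun ω => yIntercept (L ω) n) μ := by
  have slope : ∀ n, AEMeasurable (fun ω => changeTime (L ω) n) μ →
      AEMeasurable (fun ω => seminalSlope (L ω) (changeTime (L ω) n)) μ := by
    intro n hn
    refine aemeasurable_of_nullMeasurableSet_lt fun a => ?_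
    have : NullMeasurableSet (⋃ q : ℚ, ⋃ r : ℚ, ⋃ _ : 0 < r ∧ r < q,
        {ω | (q : ℝ) < changeTime (L ω) n} ∩
          {ω | seminal (L ω) q - seminal (L ω) r < a * (q - r)}) μ := by
      refine .iUnion fun q => .iUnion fun r => .iUnion fun hr => ?_
      have hr' : (0 : ℝ) < r := by exact_mod_cast hr.1
      have hq' : (0 : ℝ) < q := by exact_mod_cast hr.1.trans hr.2
      exact (nullMeasurableSet_lt aemeasurable_const hn).inter (nullMeasurableSet_lt
        ((aemeasurable_seminal hL hq').sub (aemeasurable_seminal hL hr')) aemeasurable_const)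
    refine this.congr (eventuallyEq_set.2 ?_)
    filter_upwards [ae_regular hL] with ω hω
    refine Iff.trans ?_ (hω.lead_slope_lt_iff n a).symm
    simp only [mem_iUnion, mem_inter_iff, mem_ofPred_eq, exists_prop]
  induction n with
  | zero =>
    have h0 : AEMeasurable (fun ω => changeTime (L ω) 0) μ := aemeasurable_const
    refine ⟨h0, slope 0 h0, ?_⟩
    exact (aemeasurable_seminal hL one_pos).sub (h0.mul (slope 0 h0))
  | succ n ih =>
    obtain ⟨-, ihg, ihy⟩ := ih
    have hS : AEMeasurable (fun ω => changeTime (L ω) (n + 1)) μ := by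
      refine aemeasurable_of_nullMeasurableSet_lt fun t => ?_
      have : NullMeasurableSet (⋃ q : ℚ, ⋃ _ : 0 < q ∧ (q : ℝ) < t,
          {ω | seminal (L ω) q =
            yIntercept (L ω) n + seminalSlope (L ω) (changeTime (L ω) n) * q}) μ := by
        refine .iUnion fun q => .iUnion fun hq => ?_
        have hq' : (0 : ℝ) < q := by exact_mod_cast hq.1
        exact nullMeasurableSet_eq_fun (aemeasurable_seminal hL hq')
          (ihy.add (ihg.mul_const _))
      refine this.congr (eventuallyEq_set.2 ?_)
      filter_upwards [ae_regular hL] with ω hω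
      simpa [mem_iUnion] using (hω.changeTime_succ_lt_iff n t).symm
    refine ⟨hS, slope _ hS, ?_⟩
    refine ((ihy.add (ihg.mul hS)).sub (hS.mul (slope _ hS))).congr ?_
    filter_upwards [ae_regular hL] with ω hω
    exact (hω.yIntercept_succ n).symm

end

/-! ### Convex chains of points and the regions below them -/

/-- The time at which the lines with coordinates `p` and `q` have the same height (`0` if they are
parallel). -/
noncomputable def crossTime (p q : ℝ × ℝ) : ℝ := (p.1 - q.1) / (q.2 - p.2)

/-- The times at which a sequence of lines with increasing slopes is run through from time `1`
downwards. -/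
noncomputable def corner (x : ℕ → ℝ × ℝ) : ℕ → ℝ
  | 0 => 1
  | i + 1 => crossTime (x i) (x (i + 1))

/-- The sequence `x`, up to the index `n`, consists of the coordinates of lines which may be the
first lead lines of a line pattern. -/
structure IsChain (n : ℕ) (x : ℕ → ℝ × ℝ) : Prop where
  mem : ∀ i ≤ n, x i ∈ quadrant
  fst_lt : ∀ i < n, (x (i + 1)).1 < (x i).1
  snd_lt : ∀ i < n, (x i).2 < (x (i + 1)).2
  corner_lt : ∀ i < n, corner x (i + 1) < corner x i

lemma IsChain.pred {n : ℕ} {x : ℕ → ℝ × ℝ} (h : IsChain (n + 1) x) : IsChain n x :=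
  ⟨fun i hi => h.mem i (by omega), fun i hi => h.fst_lt i (by omega),
    fun i hi => h.snd_lt i (by omega), fun i hi => h.corner_lt i (by omega)⟩

lemma IsChain.corner_pos {n : ℕ} {x : ℕ → ℝ × ℝ} (h : IsChain n x) : ∀ i ≤ n, 0 < corner x i := by
  rintro (_ | i) hi
  · exact one_pos
  · exact div_pos (sub_pos.2 (h.fst_lt i hi)) (sub_pos.2 (h.snd_lt i hi))

/-- At a crossing time the two lines have the same height. -/
lemma crossTime_spec {p q : ℝ × ℝ} (h : p.2 < q.2) :
    p.1 + p.2 * crossTime p q = q.1 + q.2 * crossTime p q := by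
  have : q.2 - p.2 ≠ 0 := (sub_pos.2 h).ne'
  rw [crossTime]; field_simp; ring

/-- The intensity of the region below a chain. -/
noncomputable def chainMass (x : ℕ → ℝ × ℝ) : ℕ → ℝ
  | 0 => ((x 0).1 + (x 0).2) ^ 2 / 4
  | n + 1 => chainMass x n + (x n).1 ^ 2 / 4 * (1 / corner x (n + 1) - 1 / corner x n)

lemma IsChain.inv_corner_le {n : ℕ} {x : ℕ → ℝ × ℝ} (h : IsChain (n + 1) x) :
    1 / corner x n ≤ 1 / corner x (n + 1) :=
  one_div_le_one_div_of_le (h.corner_pos (n + 1) le_rfl) (h.corner_lt n (by omega)).le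

lemma IsChain.chainMass_nonneg {n : ℕ} {x : ℕ → ℝ × ℝ} (h : IsChain n x) :
    0 ≤ chainMass x n := by
  induction n with
  | zero => simp only [chainMass]; positivity
  | succ n ih =>
    exact add_nonneg (ih h.pred) (mul_nonneg (by positivity) (sub_nonneg.2 h.inv_corner_le))

/-- The points of the open quadrant below the line through the `i`th corner of a chain. -/
def belowCorner (x : ℕ → ℝ × ℝ) (i : ℕ) : Set (ℝ × ℝ) :=
  {p ∈ quadrant | p.1 + p.2 * corner x i < (x i).1 + (x i).2 * corner x i}

lemma isOpen_belowCorner (x : ℕ → ℝ × ℝ) (i : ℕ) : IsOpen (belowCorner x i) :=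
  isOpen_quadrant.inter (isOpen_lt (f := fun p : ℝ × ℝ => p.1 + p.2 * corner x i)
    (g := fun _ => (x i).1 + (x i).2 * corner x i) (by fun_prop) (by fun_prop))

/-- The points of the closed quadrant on or below a line through one of the first corners. -/
def closedBelow (n : ℕ) (x : ℕ → ℝ × ℝ) : Set (ℝ × ℝ) :=
  {p | 0 ≤ p.1 ∧ 0 ≤ p.2 ∧ ∃ i ≤ n, p.1 + p.2 * corner x i ≤ (x i).1 + (x i).2 * corner x i}

/-- The triangle with apex `(C, g)` between two lines of inverse slopes `-a` and `-b`. -/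
lemma volume_triangle {C g a b : ℝ} (hC : 0 ≤ C) (hab : a ≤ b) :
    volume {p : ℝ × ℝ | p.1 ∈ Icc 0 C ∧ p.2 ∈ Icc (g + (C - p.1) * a) (g + (C - p.1) * b)} =
      ENNReal.ofReal (C ^ 2 / 2 * (b - a)) := by
  have hm : MeasurableSet {p : ℝ × ℝ | p.1 ∈ Icc 0 C ∧
      p.2 ∈ Icc (g + (C - p.1) * a) (g + (C - p.1) * b)} := by
    refine (measurable_fst measurableSet_Icc).inter ?_
    exact (measurableSet_le (f := fun p : ℝ × ℝ => g + (C - p.1) * a) (g := fun p => p.2)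
      (by fun_prop) (by fun_prop)).inter
      (measurableSet_le (f := fun p : ℝ × ℝ => p.2) (g := fun p => g + (C - p.1) * b)
        (by fun_prop) (by fun_prop))
  rw [Measure.volume_eq_prod, Measure.prod_apply hm]
  have hsl : ∀ c, volume (Prod.mk c ⁻¹' {p : ℝ × ℝ | p.1 ∈ Icc 0 C ∧
      p.2 ∈ Icc (g + (C - p.1) * a) (g + (C - p.1) * b)}) =
      (Icc 0 C).indicator (fun c => ENNReal.ofReal ((C - c) * (b - a))) c := by
    intro c
    by_cases hc : c ∈ Icc 0 C
    · rw [indicator_of_mem hc]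
      have : Prod.mk c ⁻¹' {p : ℝ × ℝ | p.1 ∈ Icc 0 C ∧
          p.2 ∈ Icc (g + (C - p.1) * a) (g + (C - p.1) * b)} =
          Icc (g + (C - c) * a) (g + (C - c) * b) := by
        ext y
        simp only [mem_preimage, mem_ofPred_eq]
        exact and_iff_right hc
      rw [this, Real.volume_Icc]
      congr 1; ring
    · rw [indicator_of_notMem hc]
      have : Prod.mk c ⁻¹' {p : ℝ × ℝ | p.1 ∈ Icc 0 C ∧
          p.2 ∈ Icc (g + (C - p.1) * a) (g + (C - p.1) * b)} = ∅ := by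
        ext y
        simp only [mem_preimage, mem_ofPred_eq, mem_empty_iff_false, iff_false]
        exact fun h => hc h.1
      rw [this, measure_empty]
  simp_rw [hsl]
  rw [lintegral_indicator measurableSet_Icc, ← ofReal_integral_eq_lintegral_ofReal]
  · congr 1
    rw [integral_Icc_eq_integral_Ioc, ← intervalIntegral.integral_of_le hC,
      intervalIntegral.integral_mul_const, intervalIntegral.integral_sub (by simp) (by simp)]
    rw [intervalIntegral.integral_const, integral_id, smul_eq_mul]
    ring
  · exact (Continuous.integrableOn_Icc (by fun_prop))
  · filter_upwards [ae_restrict_mem measurableSet_Icc] with c hc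
    exact mul_nonneg (sub_nonneg.2 hc.2) (sub_nonneg.2 hab)

/-- The region below a chain is covered by the triangle below its first line at time `1` and the
triangles swept when the supporting line rotates about the vertices of the chain. -/
lemma IsChain.intensity_closedBelow_le {n : ℕ} {x : ℕ → ℝ × ℝ} (h : IsChain n x) :
    intensity (closedBelow n x) ≤ ENNReal.ofReal (chainMass x n) := by
  have half : ∀ a : ℝ, 2⁻¹ * ENNReal.ofReal (a / 2) = ENNReal.ofReal (a / 4) := by
    intro a
    rw [show a / 4 = 2⁻¹ * (a / 2) by ring, ENNReal.ofReal_mul (p := 2⁻¹) (by norm_num),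
      ENNReal.ofReal_inv_of_pos two_pos, ENNReal.ofReal_ofNat]
  induction n with
  | zero =>
    have hx := mem_quadrant.1 (h.mem 0 le_rfl)
    have hC : 0 ≤ (x 0).1 + (x 0).2 := (add_pos hx.1 hx.2).le
    have hsub : closedBelow 0 x ⊆ {p : ℝ × ℝ | p.1 ∈ Icc 0 ((x 0).1 + (x 0).2) ∧
        p.2 ∈ Icc (0 + ((x 0).1 + (x 0).2 - p.1) * 0) (0 + ((x 0).1 + (x 0).2 - p.1) * 1)} := by
      rintro p ⟨h1, h2, i, hi, h3⟩
      obtain rfl : i = 0 := by omega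
      simp only [corner, mul_one] at h3
      refine ⟨⟨h1, by linarith⟩, by linarith, by linarith⟩
    refine (measure_mono hsub).trans_eq ?_
    rw [intensity_apply, volume_triangle hC zero_le_one, chainMass, sub_zero, mul_one, half]
  | succ n ih =>
    have hxn := mem_quadrant.1 (h.mem n (by omega))
    have hS := h.corner_pos n (by omega)
    have hS' := h.corner_pos (n + 1) le_rfl
    have hlt := h.corner_lt n (by omega)
    have hinv := h.inv_corner_le
    set T : Set (ℝ × ℝ) := {p : ℝ × ℝ | p.1 ∈ Icc 0 (x n).1 ∧
        p.2 ∈ Icc ((x n).2 + ((x n).1 - p.1) * (1 / corner x n))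
          ((x n).2 + ((x n).1 - p.1) * (1 / corner x (n + 1)))} with hT
    have hsub : closedBelow (n + 1) x ⊆ closedBelow n x ∪ T := by
      rintro p ⟨h1, h2, i, hi, h3⟩
      by_cases hp : p ∈ closedBelow n x
      · exact Or.inl hp
      have hni : i = n + 1 := by
        by_contra hne
        exact hp ⟨h1, h2, i, by omega, h3⟩
      subst hni
      have h4 : (x n).1 + (x n).2 * corner x n < p.1 + p.2 * corner x n := by
        by_contra! hc
        exact hp ⟨h1, h2, n, le_rfl, hc⟩
      have e : (x n).1 + (x n).2 * corner x (n + 1) =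
        (x (n + 1)).1 + (x (n + 1)).2 * corner x (n + 1) := crossTime_spec (h.snd_lt n (by omega))
      rw [← e] at h3
      have h5 : (x n).2 < p.2 := by
        by_contra! hc
        nlinarith
      refine Or.inr ⟨⟨h1, ?_⟩, ?_, ?_⟩
      · nlinarith
      · have : ((x n).1 - p.1) * (1 / corner x n) ≤ p.2 - (x n).2 := by
          rw [mul_one_div, div_le_iff₀ hS]; linarith
        linarith
      · have : p.2 - (x n).2 ≤ ((x n).1 - p.1) * (1 / corner x (n + 1)) := by
          rw [mul_one_div, le_div_iff₀ hS']; linarith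
        linarith
    refine (measure_mono hsub).trans ((measure_union_le _ _).trans ?_)
    rw [chainMass, ENNReal.ofReal_add h.pred.chainMass_nonneg
      (mul_nonneg (by positivity) (sub_nonneg.2 hinv))]
    refine add_le_add (ih h.pred) (le_of_eq ?_)
    rw [intensity_apply, hT, volume_triangle hxn.1.le hinv, div_mul_eq_mul_div, half,
      div_mul_eq_mul_div]

/-- A finite sequence, continued periodically. This is a total and continuous way of reading off
its terms with natural numbers for indices. -/
def extend {n : ℕ} (x : Fin (n + 1) → ℝ × ℝ) (i : ℕ) : ℝ × ℝ := x (Fin.ofNat (n + 1) i)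

lemma extend_apply {n : ℕ} (x : Fin (n + 1) → ℝ × ℝ) (i : Fin (n + 1)) : extend x i = x i := by
  simp [extend]

@[fun_prop]
lemma continuous_extend {n : ℕ} (i : ℕ) :
    Continuous fun x : Fin (n + 1) → ℝ × ℝ => extend x i :=
  continuous_apply _

lemma continuousAt_corner {n : ℕ} {x : Fin (n + 1) → ℝ × ℝ} (h : IsChain n (extend x)) {i : ℕ}
    (hi : i ≤ n) : ContinuousAt (fun x : Fin (n + 1) → ℝ × ℝ => corner (extend x) i) x := by
  cases i with
  | zero => exact continuousAt_const
  | succ i =>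
    refine ContinuousAt.div ?_ ?_ (sub_pos.2 (h.snd_lt i hi)).ne'
    · exact Continuous.continuousAt (by fun_prop)
    · exact Continuous.continuousAt (by fun_prop)

lemma IsChain.eventually {n : ℕ} {x : Fin (n + 1) → ℝ × ℝ} (h : IsChain n (extend x)) :
    ∀ᶠ y in 𝓝 x, IsChain n (extend y) := by
  have h1 : ∀ᶠ y in 𝓝 x, ∀ i ∈ Finset.range (n + 1), extend y i ∈ quadrant := by
    rw [Filter.eventually_all_finset]
    intro i hi
    exact (continuous_extend i).continuousAt.eventually_mem
      (isOpen_quadrant.mem_nhds (h.mem i (by simpa [Nat.lt_succ_iff] using hi)))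
  have h2 : ∀ᶠ y in 𝓝 x, ∀ i ∈ Finset.range n, (extend y (i + 1)).1 < (extend y i).1 ∧
      (extend y i).2 < (extend y (i + 1)).2 ∧
      corner (extend y) (i + 1) < corner (extend y) i := by
    rw [Filter.eventually_all_finset]
    intro i hi
    have hi := Finset.mem_range.1 hi
    refine (ContinuousAt.eventually_lt ?_ ?_ (h.fst_lt i hi)).and
      ((ContinuousAt.eventually_lt ?_ ?_ (h.snd_lt i hi)).and
        (ContinuousAt.eventually_lt (continuousAt_corner h hi) (continuousAt_corner h hi.le)
          (h.corner_lt i hi)))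
    all_goals exact Continuous.continuousAt (by fun_prop)
  filter_upwards [h1, h2] with y h1 h2
  exact ⟨fun i hi => h1 i (Finset.mem_range.2 (by omega)),
    fun i hi => (h2 i (Finset.mem_range.2 hi)).1, fun i hi => (h2 i (Finset.mem_range.2 hi)).2.1,
    fun i hi => (h2 i (Finset.mem_range.2 hi)).2.2⟩

/-- The union of the regions below the chains close to `x`. -/
def nearBelow {n : ℕ} (x : Fin (n + 1) → ℝ × ℝ) (r : ℝ) : Set (ℝ × ℝ) :=
  ⋃ y ∈ Metric.ball x (2 * r), ⋃ i ∈ Iic n, belowCorner (extend y) i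

lemma isOpen_nearBelow {n : ℕ} (x : Fin (n + 1) → ℝ × ℝ) (r : ℝ) : IsOpen (nearBelow x r) :=
  isOpen_biUnion fun _ _ => isOpen_biUnion fun _ _ => isOpen_belowCorner _ _

lemma nearBelow_mono {n : ℕ} (x : Fin (n + 1) → ℝ × ℝ) {r s : ℝ} (h : r ≤ s) :
    nearBelow x r ⊆ nearBelow x s :=
  biUnion_subset_biUnion_left (Metric.ball_subset_ball (by linarith))

lemma mem_nearBelow {n : ℕ} {x : Fin (n + 1) → ℝ × ℝ} {r : ℝ} {p : ℝ × ℝ} :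
    p ∈ nearBelow x r ↔ ∃ y ∈ Metric.ball x (2 * r), ∃ i ≤ n, p ∈ belowCorner (extend y) i := by
  simp only [nearBelow, mem_iUnion, mem_Iic, exists_prop]

lemma IsChain.iInter_nearBelow_subset {n : ℕ} {x : Fin (n + 1) → ℝ × ℝ}
    (h : IsChain n (extend x)) : ⋂ r > 0, nearBelow x r ⊆ closedBelow n (extend x) := by
  intro p hp
  simp only [mem_iInter] at hp
  by_contra hpK
  obtain ⟨-, -, -, -, hq, -⟩ := mem_nearBelow.1 (hp 1 one_pos)
  have hpos := mem_quadrant.1 hq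
  have hev : ∀ᶠ y in 𝓝 x, ∀ i ∈ Finset.range (n + 1),
      (extend y i).1 + (extend y i).2 * corner (extend y) i < p.1 + p.2 * corner (extend y) i := by
    rw [Filter.eventually_all_finset]
    intro i hi
    have hi : i ≤ n := by simpa [Nat.lt_succ_iff] using hi
    have hc := continuousAt_corner h hi
    refine ContinuousAt.eventually_lt (ContinuousAt.add ?_ (ContinuousAt.mul ?_ hc))
      (continuousAt_const.add (continuousAt_const.mul hc)) ?_
    · exact Continuous.continuousAt (by fun_prop)
    · exact Continuous.continuousAt (by fun_prop)
    · by_contra! hle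
      exact hpK ⟨hpos.1.le, hpos.2.le, i, hi, hle⟩
  obtain ⟨ε, hε, hball⟩ := Metric.eventually_nhds_iff_ball.1 hev
  obtain ⟨y, hy, i, hi, -, hlt⟩ := mem_nearBelow.1 (hp (ε / 2) (by positivity))
  rw [mul_div_cancel₀ _ two_ne_zero] at hy
  exact absurd hlt (not_lt.2 (hball y hy i (Finset.mem_range.2 (by omega))).le)

lemma IsChain.exists_intensity_nearBelow_ne_top {n : ℕ} {x : Fin (n + 1) → ℝ × ℝ}
    (h : IsChain n (extend x)) : ∃ r > 0, intensity (nearBelow x r) ≠ ∞ := by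
  set H : ℕ → ℝ := fun i => (extend x i).1 + (extend x i).2 * corner (extend x) i + 1 with hH
  have hev : ∀ᶠ y in 𝓝 x, ∀ i ∈ Finset.range (n + 1),
      corner (extend x) i / 2 < corner (extend y) i ∧
      (extend y i).1 + (extend y i).2 * corner (extend y) i < H i := by
    rw [Filter.eventually_all_finset]
    intro i hi
    have hi : i ≤ n := by simpa [Nat.lt_succ_iff] using hi
    have hc := continuousAt_corner h hi
    refine (ContinuousAt.eventually_lt continuousAt_const hc
      (half_lt_self (h.corner_pos i hi))).and (ContinuousAt.eventually_lt
        (ContinuousAt.add ?_ (ContinuousAt.mul ?_ hc)) continuousAt_const (lt_add_one _))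
    · exact Continuous.continuousAt (by fun_prop)
    · exact Continuous.continuousAt (by fun_prop)
  obtain ⟨ε, hε, hball⟩ := Metric.eventually_nhds_iff_ball.1 hev
  refine ⟨ε / 2, by positivity, intensity_ne_top ?_⟩
  have hsub : nearBelow x (ε / 2) ⊆ ⋃ i ∈ Finset.range (n + 1),
      Icc 0 (H i) ×ˢ Icc 0 (H i / (corner (extend x) i / 2)) := by
    intro p hp
    obtain ⟨y, hy, i, hi, hq, hlt⟩ := mem_nearBelow.1 hp
    rw [mul_div_cancel₀ _ two_ne_zero] at hy
    have hi' := Finset.mem_range.2 (Nat.lt_succ_of_le hi)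
    obtain ⟨h1, h2⟩ := hball y hy i hi'
    have hc := h.corner_pos i hi
    have hpos := mem_quadrant.1 hq
    refine mem_biUnion hi' ⟨⟨hpos.1.le, ?_⟩, hpos.2.le, ?_⟩
    · nlinarith
    · rw [le_div_iff₀ (by positivity)]
      nlinarith
  refine ((measure_mono hsub).trans_lt ?_).ne
  exact measure_biUnion_lt_top (Finset.finite_toSet _) fun i _ =>
    (isCompact_Icc.prod isCompact_Icc).measure_lt_top

lemma IsChain.exists_tendsto {n : ℕ} {x : Fin (n + 1) → ℝ × ℝ} (h : IsChain n (extend x)) :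
    ∃ m ≤ ENNReal.ofReal (chainMass (extend x) n),
      Tendsto (fun r => intensity (nearBelow x r)) (𝓝[>] 0) (𝓝 m) :=
  ⟨intensity (⋂ r > 0, nearBelow x r),
    (measure_mono h.iInter_nearBelow_subset).trans h.intensity_closedBelow_le,
    tendsto_measure_biInter_gt (fun r _ => (isOpen_nearBelow x r).measurableSet.nullMeasurableSet)
      (fun _ _ _ hij => nearBelow_mono x hij) h.exists_intensity_nearBelow_ne_top⟩

/-! ### A lower bound for the joint law of the first lead lines -/

/-- The density of the coordinates `q` of the next lead line, given the coordinates `p` of a lead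
line which takes over at the time `s`. -/
noncomputable def transDens (s : ℝ) (p q : ℝ × ℝ) : ℝ≥0∞ :=
  open scoped Classical in
  if (0 < q.1 ∧ q.1 < p.1) ∧ p.2 < q.2 ∧ crossTime p q < s then
    2⁻¹ * ENNReal.ofReal (Real.exp (-(p.1 ^ 2 / 4 * (1 / crossTime p q - 1 / s)))) else 0

/-- The density of the coordinates of the first lead line. -/
noncomputable def startDens (p : ℝ × ℝ) : ℝ≥0∞ :=
  quadrant.indicator (fun p => 2⁻¹ * ENNReal.ofReal (Real.exp (-((p.1 + p.2) ^ 2 / 4)))) p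

/-- The joint density of the coordinates of the lead lines up to the index `n`. -/
noncomputable def chainDens (x : ℕ → ℝ × ℝ) : ℕ → ℝ≥0∞
  | 0 => startDens (x 0)
  | n + 1 => chainDens x n * transDens (corner x n) (x n) (x (n + 1))

lemma isChain_of_chainDens_ne_zero {x : ℕ → ℝ × ℝ} {n : ℕ} (h : chainDens x n ≠ 0) :
    IsChain n x := by
  induction n with
  | zero =>
    refine ⟨fun i hi => ?_, fun i hi => absurd hi (by omega), fun i hi => absurd hi (by omega),
      fun i hi => absurd hi (by omega)⟩
    obtain rfl : i = 0 := by omega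
    by_contra hx
    exact h (by rw [chainDens, startDens, indicator_of_notMem hx])
  | succ n ih =>
    have hc := ih (left_ne_zero_of_mul h)
    have ht := right_ne_zero_of_mul h
    rw [transDens] at ht
    have ht' := (ite_ne_right_iff.1 ht).1
    have hn := mem_quadrant.1 (hc.mem n le_rfl)
    refine ⟨fun i hi => ?_, fun i hi => ?_, fun i hi => ?_, fun i hi => ?_⟩
    · rcases Nat.lt_or_ge n i with h | h
      · obtain rfl : i = n + 1 := by omega
        exact ⟨ht'.1.1, hn.2.trans ht'.2.1⟩
      · exact hc.mem i h
    all_goals rcases Nat.lt_or_ge i n with h | h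
    · exact hc.fst_lt i h
    · obtain rfl : i = n := by omega
      exact ht'.1.2
    · exact hc.snd_lt i h
    · obtain rfl : i = n := by omega
      exact ht'.2.1
    · exact hc.corner_lt i h
    · obtain rfl : i = n := by omega
      exact ht'.2.2

lemma IsChain.chainDens_eq {x : ℕ → ℝ × ℝ} {n : ℕ} (h : IsChain n x) :
    chainDens x n = 2⁻¹ ^ (n + 1) * ENNReal.ofReal (Real.exp (-chainMass x n)) := by
  induction n with
  | zero =>
    rw [chainDens, startDens, indicator_of_mem (h.mem 0 le_rfl), zero_add, pow_one, chainMass]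
  | succ n ih =>
    have hq := mem_quadrant.1 (h.mem (n + 1) le_rfl)
    rw [chainDens, ih h.pred, transDens, if_pos ⟨⟨hq.1, h.fst_lt n (by omega)⟩,
      h.snd_lt n (by omega), h.corner_lt n (by omega)⟩, chainMass, neg_add, Real.exp_add,
      ENNReal.ofReal_mul (Real.exp_nonneg _), pow_succ _ (n + 1)]
    simp only [corner]
    ring

/-- If there is exactly one point near each vertex of the chain `x`, and no other point below the
chains close to `x`, then the first lead lines are close to `x`. -/
lemma Regular.coord_leadLine_mem {L : Set Line} (hL : Regular L) {n : ℕ}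
    {x : Fin (n + 1) → ℝ × ℝ} {r : ℝ} (hr : 0 < r)
    (hx : ∀ y ∈ Metric.closedBall x r, IsChain n (extend y))
    (h1 : ∀ i, (coord '' L ∩ Metric.closedBall (x i) r).encard = 1)
    (h0 : coord '' L ∩ (nearBelow x r \ ⋃ i, Metric.closedBall (x i) r) = ∅) :
    (fun i : Fin (n + 1) => coord (leadLine L i)) ∈ Metric.closedBall x r := by
  choose y hy using fun i => encard_eq_one.1 (h1 i)
  have hyL : ∀ i, y i ∈ coord '' L ∩ Metric.closedBall (x i) r := fun i =>
    (hy i).symm ▸ mem_singleton (y i)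
  have hyx : y ∈ Metric.closedBall x r := by
    rw [closedBall_pi x hr.le]
    exact fun i _ => (hyL i).2
  have hc := hx y hyx
  have key := hL.leadLine_eq_of_chain n (fun i => coord.symm (extend y i)) (corner (extend y)) rfl
    hc.corner_lt hc.corner_pos
    (fun i hi => coord_symm_mem_positiveLines.2 ⟨(hyL _).1, hc.mem i hi⟩)
    (fun i hi => by
      simp only [coord_symm_height]
      exact crossTime_spec (hc.snd_lt i hi))
    (fun i hi => by simpa only [coord_symm_slope] using hc.snd_lt i hi) ?_
  · convert hyx using 2 with i
    rw [(key i (Nat.lt_succ_iff.1 i.2)).1, coord.apply_symm_apply, extend_apply]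
  · intro m hm hne i hi
    have hmq := coord_symm_mem_positiveLines.1 ((coord.symm_apply_apply m).symm ▸ hm)
    rw [← coord.symm_apply_apply m, coord_symm_height, coord_symm_height]
    by_contra! hle
    have hout : coord m ∉ ⋃ i, Metric.closedBall (x i) r := by
      intro hmem
      obtain ⟨j, hj⟩ := mem_iUnion.1 hmem
      have : coord m ∈ ({y j} : Set (ℝ × ℝ)) := hy j ▸ ⟨hmq.1, hj⟩
      refine hne j (Nat.lt_succ_iff.1 j.2) ?_
      simp only [extend_apply]
      rw [← mem_singleton_iff.1 this, coord.symm_apply_apply]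
    -- raising all points of the chain by the same amount turns `≤` into `<`
    have hin : coord m ∈ nearBelow x r := by
      set z : Fin (n + 1) → ℝ × ℝ := fun i => ((y i).1 + r / 2, (y i).2) with hz
      have hzy : dist z y ≤ r / 2 := by
        refine (dist_pi_le_iff (by positivity)).2 fun i => ?_
        rw [hz, Prod.dist_eq]
        refine max_le ?_ ?_
        · simp only [Real.dist_eq, add_sub_cancel_left]
          rw [abs_of_pos (by positivity)]
        · simp only [dist_self]; positivity
      have hcorner : ∀ j, corner (extend z) j = corner (extend y) j := by
        rintro (_ | j)
        · rfl
        · simp only [corner, crossTime, extend, hz, add_sub_add_right_eq_sub]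
      refine mem_nearBelow.2 ⟨z, ?_, i, hi, hmq.2, ?_⟩
      · rw [Metric.mem_ball]
        have := dist_triangle z y x
        have := Metric.mem_closedBall.1 hyx
        linarith
      · rw [hcorner]
        have e1 : (extend z i).1 = (extend y i).1 + r / 2 := rfl
        have e2 : (extend z i).2 = (extend y i).2 := rfl
        rw [e1, e2]
        linarith
    exact eq_empty_iff_forall_notMem.1 h0 _ ⟨hmq.1, hin, hout⟩

section

variable {Ω : Type*} [MeasurableSpace Ω] {μ : Measure Ω} {L : Ω → Set Line}

/-- The coordinates of the first lead lines. -/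
noncomputable def leadCoords (L : Ω → Set Line) (n : ℕ) (ω : Ω) (i : Fin (n + 1)) : ℝ × ℝ :=
  coord (leadLine (L ω) i)

lemma aemeasurable_leadCoords (hL : IsPoissonProcess L lineIntensity μ) (n : ℕ) :
    AEMeasurable (leadCoords L n) μ := by
  refine aemeasurable_pi_lambda _ fun i => ?_
  obtain ⟨-, hg, hy⟩ := aemeasurable_lead hL i
  simp only [leadCoords, coord_apply, leadLine_height, leadLine_slope]
  exact hy.prodMk hg

/-- The lower bound for the probability that the first lead lines are close to `x`. -/
lemma measure_leadCoords_mem_closedBall (hL : IsPoissonProcess L lineIntensity μ) {n : ℕ}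
    {x : Fin (n + 1) → ℝ × ℝ} {r : ℝ} (hr : 0 < r)
    (hx : ∀ y ∈ Metric.closedBall x r, IsChain n (extend y))
    (hd : Pairwise fun i j => Disjoint (Metric.closedBall (x i) r) (Metric.closedBall (x j) r))
    (hfin : intensity (nearBelow x r) ≠ ∞) :
    (∏ i, ENNReal.ofReal (Real.exp (-(intensity (Metric.closedBall (x i) r)).toReal)) *
        intensity (Metric.closedBall (x i) r)) *
      ENNReal.ofReal (Real.exp (-(intensity (nearBelow x r)).toReal)) ≤
    μ.map (leadCoords L n) (Metric.closedBall x r) := by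
  have hP := hL.coord
  set Q : Fin (n + 1) → Set (ℝ × ℝ) := fun i => Metric.closedBall (x i) r with hQ
  set R : Set (ℝ × ℝ) := nearBelow x r \ ⋃ i, Q i with hR
  have hQm : ∀ i, MeasurableSet (Q i) := fun i => Metric.isClosed_closedBall.measurableSet
  have hRm : MeasurableSet R :=
    (isOpen_nearBelow x r).measurableSet.diff (MeasurableSet.iUnion hQm)
  have hQfin : ∀ i, intensity (Q i) ≠ ∞ := fun i =>
    intensity_ne_top (isCompact_closedBall _ _).measure_lt_top.ne
  have hRle : intensity R ≤ intensity (nearBelow x r) := measure_mono sdiff_subset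
  have hRfin : intensity R ≠ ∞ := ne_top_of_le_ne_top hfin hRle
  set B : Fin (n + 2) → Set (ℝ × ℝ) := Fin.cons R Q with hB
  set k : Fin (n + 2) → Set ℕ∞ := Fin.cons {0} fun _ => {1} with hk
  have hBm : ∀ i, MeasurableSet (B i) := by
    intro i
    refine Fin.cases ?_ (fun j => ?_) i
    · exact hRm
    · exact hQm j
  have hRQ : ∀ j, Disjoint R (Q j) := fun j =>
    disjoint_sdiff_left.mono_right (subset_iUnion Q j)
  have hBd : Pairwise fun i j => Disjoint (B i) (B j) := by
    intro i j
    refine Fin.cases (fun hij => ?_) (fun i hij => ?_) i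
    · revert hij
      refine Fin.cases (fun hij => absurd rfl hij) (fun j _ => ?_) j
      exact hRQ j
    · revert hij
      refine Fin.cases (fun _ => ?_) (fun j hij => ?_) j
      · exact (hRQ i).symm
      · exact hd fun h => hij (congrArg _ h)
  have hind := (hP.indep_count (n + 2) B hBm hBd).measure_inter_preimage_eq_mul Finset.univ
    (sets := k) fun i _ => by
      refine Fin.cases ?_ (fun j => ?_) i
      · exact measurableSet_singleton _
      · exact measurableSet_singleton _
  rw [Fin.prod_univ_succ] at hind
  have e0 : μ (count (fun ω => PoissonCity.coord '' L ω) (B 0) ⁻¹' k 0) =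
      ENNReal.ofReal (Real.exp (-(intensity R).toReal)) :=
    hP.measure_count_eq_zero hRm hRfin
  have e1 : ∀ i : Fin (n + 1),
      μ (count (fun ω => PoissonCity.coord '' L ω) (B i.succ) ⁻¹' k i.succ) =
      ENNReal.ofReal (Real.exp (-(intensity (Q i)).toReal)) * intensity (Q i) :=
    fun i => hP.measure_count_eq_one (hQm i) (hQfin i)
  rw [e0] at hind
  simp_rw [e1] at hind
  have hle : (∏ i, ENNReal.ofReal (Real.exp (-(intensity (Q i)).toReal)) * intensity (Q i)) *
      ENNReal.ofReal (Real.exp (-(intensity (nearBelow x r)).toReal)) ≤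
      ENNReal.ofReal (Real.exp (-(intensity R).toReal)) *
        ∏ i, ENNReal.ofReal (Real.exp (-(intensity (Q i)).toReal)) * intensity (Q i) := by
    rw [mul_comm]
    gcongr
  refine hle.trans ?_
  rw [← hind, Measure.map_apply_of_aemeasurable (aemeasurable_leadCoords hL n)
    Metric.isClosed_closedBall.measurableSet]
  refine measure_mono_ae ?_
  filter_upwards [ae_regular hL] with ω hω hmem
  have hmem' : ∀ i, ω ∈ count (fun ω => PoissonCity.coord '' L ω) (B i) ⁻¹' k i := fun i =>
    mem_iInter₂.1 hmem i (Finset.mem_univ i)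
  exact hω.coord_leadLine_mem hr hx (fun i => hmem' i.succ) (count_eq_zero_iff.1 (hmem' 0))

lemma volume_closedBall_prod (p : ℝ × ℝ) {r : ℝ} :
    volume (Metric.closedBall p r) = ENNReal.ofReal (2 * r) * ENNReal.ofReal (2 * r) := by
  rw [← closedBall_prod_same, Measure.volume_eq_prod, Measure.prod_prod, Real.volume_closedBall,
    Real.volume_closedBall]

lemma IsChain.injective {n : ℕ} {x : Fin (n + 1) → ℝ × ℝ} (h : IsChain n (extend x)) :
    Function.Injective x := by
  have hm : StrictMono fun i : Fin (n + 1) => (x i).2 := by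
    refine Fin.strictMono_iff_lt_succ.2 fun i => ?_
    have := h.snd_lt i i.2
    rwa [show ((i : ℕ) + 1) = (i.succ : Fin (n + 1)) by simp, extend_apply,
      show (i : ℕ) = (i.castSucc : Fin (n + 1)) by simp, extend_apply] at this
  exact fun i j hij => hm.injective (congrArg Prod.snd hij)

/-- The density of the joint law of the first lead lines is at least `chainDens`. -/
lemma ae_chainDens_le_rnDeriv [IsProbabilityMeasure μ] (hL : IsPoissonProcess L lineIntensity μ)
    (n : ℕ) :
    ∀ᵐ x : Fin (n + 1) → ℝ × ℝ,
      chainDens (extend x) n ≤ (μ.map (leadCoords L n)).rnDeriv volume x := by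
  have := Measure.isProbabilityMeasure_map (aemeasurable_leadCoords hL n)
  filter_upwards [Besicovitch.ae_tendsto_rnDeriv (μ.map (leadCoords L n))
    (volume : Measure (Fin (n + 1) → ℝ × ℝ))] with x hlim
  by_cases hx : chainDens (extend x) n = 0
  · rw [hx]; exact bot_le
  have hc := isChain_of_chainDens_ne_zero hx
  obtain ⟨m, hm, hmlim⟩ := hc.exists_tendsto
  have hmtop : m ≠ ∞ := ne_top_of_le_ne_top ENNReal.ofReal_ne_top hm
  have hI : Tendsto (fun r => (intensity (nearBelow x r)).toReal) (𝓝[>] 0) (𝓝 m.toReal) :=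
    (ENNReal.tendsto_toReal hmtop).comp hmlim
  have hlow : Tendsto (fun r : ℝ => (2⁻¹ : ℝ≥0∞) ^ (n + 1) * ENNReal.ofReal
      (Real.exp (-(2 * r ^ 2)) ^ (n + 1) * Real.exp (-(intensity (nearBelow x r)).toReal)))
      (𝓝[>] 0) (𝓝 (2⁻¹ ^ (n + 1) * ENNReal.ofReal (Real.exp (-m.toReal)))) := by
    refine ENNReal.Tendsto.const_mul (ENNReal.tendsto_ofReal ?_)
      (Or.inr (ENNReal.pow_ne_top (by simp)))
    have h1 : Tendsto (fun r : ℝ => Real.exp (-(2 * r ^ 2)) ^ (n + 1)) (𝓝[>] 0) (𝓝 1) := by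
      have : Continuous fun r : ℝ => Real.exp (-(2 * r ^ 2)) ^ (n + 1) := by fun_prop
      simpa using (this.tendsto 0).mono_left nhdsWithin_le_nhds
    have h2 := (Real.continuous_exp.tendsto _).comp hI.neg
    simpa using h1.mul h2
  have hle : chainDens (extend x) n ≤ 2⁻¹ ^ (n + 1) * ENNReal.ofReal (Real.exp (-m.toReal)) := by
    rw [hc.chainDens_eq]
    gcongr
    exact ENNReal.toReal_le_of_le_ofReal hc.chainMass_nonneg hm
  refine hle.trans (le_of_tendsto_of_tendsto hlow hlim ?_)
  -- all requirements on `r` for the lower bound hold when `r` is small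
  have hsmall1 : ∀ᶠ r in 𝓝[>] (0 : ℝ), ∀ y ∈ Metric.closedBall x r, IsChain n (extend y) := by
    obtain ⟨ε, hε, hball⟩ := Metric.nhds_basis_closedBall.eventually_iff.1 hc.eventually
    filter_upwards [Ioo_mem_nhdsGT hε] with r hr y hy
    exact hball (Metric.closedBall_subset_closedBall hr.2.le hy)
  have hsmall2 : ∀ᶠ r in 𝓝[>] (0 : ℝ), Pairwise fun i j =>
      Disjoint (Metric.closedBall (x i) r) (Metric.closedBall (x j) r) := by
    have : ∀ᶠ r in 𝓝[>] (0 : ℝ), ∀ i j, i ≠ j →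
        Disjoint (Metric.closedBall (x i) r) (Metric.closedBall (x j) r) := by
      refine eventually_all.2 fun i => eventually_all.2 fun j => ?_
      by_cases hij : i = j
      · exact Eventually.of_forall fun r h => absurd hij h
      · have hd : 0 < dist (x i) (x j) / 2 := half_pos (dist_pos.2 (hc.injective.ne hij))
        filter_upwards [Ioo_mem_nhdsGT hd] with r hr _
        exact Metric.closedBall_disjoint_closedBall (by linarith [hr.2])
    filter_upwards [this] with r hr i j hij using hr i j hij
  have hsmall3 : ∀ᶠ r in 𝓝[>] (0 : ℝ), intensity (nearBelow x r) ≠ ∞ := by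
    obtain ⟨ε, hε, h⟩ := hc.exists_intensity_nearBelow_ne_top
    filter_upwards [Ioo_mem_nhdsGT hε] with r hr
    exact ne_top_of_le_ne_top h (measure_mono (nearBelow_mono x hr.2.le))
  filter_upwards [hsmall1, hsmall2, hsmall3, self_mem_nhdsWithin] with r h1 h2 h3 hr
  have hr : 0 < r := hr
  have hV : ∀ p : ℝ × ℝ, volume (Metric.closedBall p r) = ENNReal.ofReal (4 * r ^ 2) := fun p => by
    rw [volume_closedBall_prod, ← ENNReal.ofReal_mul (by positivity)]
    congr 1; ring
  have hν : ∀ p : ℝ × ℝ, (intensity (Metric.closedBall p r)).toReal = 2 * r ^ 2 := fun p => by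
    rw [intensity_apply, hV, ENNReal.toReal_mul, ENNReal.toReal_ofReal (by positivity)]
    simp only [ENNReal.toReal_inv, ENNReal.toReal_ofNat]
    ring
  have hVx : volume (Metric.closedBall x r) = ENNReal.ofReal (4 * r ^ 2) ^ (n + 1) := by
    rw [closedBall_pi x hr.le, volume_pi_pi]
    simp_rw [hV]
    rw [Finset.prod_const, Finset.card_univ, Fintype.card_fin]
  have hpos : 0 < ENNReal.ofReal (4 * r ^ 2) := ENNReal.ofReal_pos.2 (by positivity)
  rw [ENNReal.le_div_iff_mul_le (Or.inl (by rw [hVx]; exact pow_ne_zero _ hpos.ne'))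
    (Or.inl (by rw [hVx]; exact ENNReal.pow_ne_top ENNReal.ofReal_ne_top))]
  refine le_trans (le_of_eq ?_) (measure_leadCoords_mem_closedBall hL hr h1 h2 h3)
  simp_rw [hν, intensity_apply, hV]
  rw [Finset.prod_const, Finset.card_univ, Fintype.card_fin, hVx,
    ENNReal.ofReal_mul (by positivity), ENNReal.ofReal_pow (Real.exp_nonneg _), mul_pow, mul_pow,
    ← intensity_apply]
  ring

end

/-! ### Change of variables for a single step -/

lemma lintegral_expMeasure_one {f : ℝ → ℝ≥0∞} (hf : Measurable f) :
    ∫⁻ e, f e ∂(expMeasure 1) = ∫⁻ e in Ioi 0, ENNReal.ofReal (Real.exp (-e)) * f e := by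
  have h : expMeasure 1 = volume.withDensity (exponentialPDF 1) := rfl
  have hm : Measurable (exponentialPDF 1) := (measurable_exponentialPDFReal 1).ennreal_ofReal
  rw [h, lintegral_withDensity_eq_lintegral_mul _ hm hf, ← lintegral_indicator measurableSet_Ioi]
  refine lintegral_congr_ae ?_
  have h0 : ∀ᵐ e : ℝ, e ≠ 0 := by simp [ae_iff]
  filter_upwards [h0] with e he
  rw [Pi.mul_apply]
  rcases lt_or_gt_of_ne he with h' | h'
  · rw [exponentialPDF_of_neg h', indicator_of_notMem (by simpa using h'.le), zero_mul]
  · rw [exponentialPDF_of_nonneg h'.le, indicator_of_mem (mem_Ioi.2 h'), one_mul, one_mul]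

/-- The substitution `y = a + k * e`, `k > 0`, which maps `(0, ∞)` to `(a, ∞)`. -/
lemma setLIntegral_Ioi_affine {a k : ℝ} (hk : 0 < k) (g : ℝ → ℝ≥0∞) :
    ∫⁻ y in Ioi a, g y = ENNReal.ofReal k * ∫⁻ e in Ioi 0, g (a + k * e) := by
  have himg : (fun e => a + k * e) '' Ioi 0 = Ioi a := by
    ext y
    constructor
    · rintro ⟨e, he, rfl⟩
      have := mul_pos hk (mem_Ioi.1 he)
      simpa using this
    · intro hy
      refine ⟨(y - a) / k, div_pos (sub_pos.2 hy) hk, ?_⟩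
      field_simp; ring
  have hd : ∀ e ∈ Ioi (0 : ℝ), HasDerivWithinAt (fun e => a + k * e) k (Ioi 0) e := fun e _ => by
    simpa using (((hasDerivAt_id e).const_mul k).const_add a).hasDerivWithinAt
  have hinj : InjOn (fun e => a + k * e) (Ioi 0) := fun x _ y _ h => by
    have : k * x = k * y := by simpa using h
    exact mul_left_cancel₀ hk.ne' this
  rw [← himg, lintegral_image_eq_lintegral_abs_deriv_mul measurableSet_Ioi hd hinj,
    lintegral_const_mul' _ _ ENNReal.ofReal_ne_top, abs_of_pos hk]

/-- The substitution `u = ((c - a) / c)²`. -/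
lemma lintegral_Icc_eq_setLIntegral_Ioo {c : ℝ} (hc : 0 < c) (h : ℝ → ℝ≥0∞) :
    ∫⁻ u in Icc 0 1, h u =
      ∫⁻ a in Ioo 0 c, ENNReal.ofReal (2 * (c - a) / c ^ 2) * h (((c - a) / c) ^ 2) := by
  have himg : (fun a => ((c - a) / c) ^ 2) '' Ioo 0 c = Ioo 0 1 := by
    ext u
    constructor
    · rintro ⟨a, ha, rfl⟩
      have h1 : 0 < (c - a) / c := div_pos (sub_pos.2 ha.2) hc
      have h2 : (c - a) / c < 1 := by rw [div_lt_one hc]; linarith [ha.1]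
      exact ⟨by positivity, by nlinarith⟩
    · intro hu
      have h1 : 0 < √u := Real.sqrt_pos.2 hu.1
      have h2 : √u < 1 := by rw [Real.sqrt_lt' one_pos]; simpa using hu.2
      refine ⟨c - c * √u, ⟨by nlinarith, by nlinarith⟩, ?_⟩
      have : (c - (c - c * √u)) / c = √u := by field_simp; ring
      simp only [this, Real.sq_sqrt hu.1.le]
  have hd : ∀ a ∈ Ioo 0 c, HasDerivWithinAt (fun a => ((c - a) / c) ^ 2)
      (-(2 * (c - a) / c ^ 2)) (Ioo 0 c) a := fun a _ => by
    have := ((((hasDerivAt_id a).const_sub c).div_const c).pow 2).hasDerivWithinAt (s := Ioo 0 c)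
    refine this.congr_deriv ?_
    simp only [id_eq, Nat.cast_ofNat, Nat.add_one_sub_one, pow_one]
    field_simp
  have hinj : InjOn (fun a => ((c - a) / c) ^ 2) (Ioo 0 c) := fun x hx y hy hxy => by
    have h1 : 0 ≤ (c - x) / c := (div_pos (sub_pos.2 hx.2) hc).le
    have h2 : 0 ≤ (c - y) / c := (div_pos (sub_pos.2 hy.2) hc).le
    have := (sq_eq_sq₀ h1 h2).1 hxy
    field_simp at this
    linarith
  rw [setLIntegral_congr Ioo_ae_eq_Icc.symm, ← himg,
    lintegral_image_eq_lintegral_abs_deriv_mul measurableSet_Ioo hd hinj]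
  refine setLIntegral_congr_fun measurableSet_Ioo fun a ha => ?_
  have : 0 ≤ 2 * (c - a) / c ^ 2 := div_nonneg (by linarith [ha.2]) (by positivity)
  simp only [abs_neg, abs_of_nonneg this]

/-- The variable `E` of the step from the line `p`, which takes over at the time `s`, to the
line `q`: the intensity of the triangle swept. -/
noncomputable def stepE (s : ℝ) (p q : ℝ × ℝ) : ℝ := p.1 ^ 2 / 4 * (1 / crossTime p q - 1 / s)

/-- The variable `U` of the step from the line `p` to the line `q`. Its square root is the position
of `q` on the segment from `p` to the axis of the slopes. -/
noncomputable def stepU (p q : ℝ × ℝ) : ℝ := ((q.2 - p.2) * crossTime p q / p.1) ^ 2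

lemma measurable_crossTime : Measurable fun z : (ℝ × ℝ) × (ℝ × ℝ) => crossTime z.1 z.2 := by
  unfold crossTime; fun_prop

lemma measurable_stepE :
    Measurable fun z : ℝ × (ℝ × ℝ) × (ℝ × ℝ) => stepE z.1 z.2.1 z.2.2 := by
  have : Measurable fun z : ℝ × (ℝ × ℝ) × (ℝ × ℝ) => crossTime z.2.1 z.2.2 :=
    measurable_crossTime.comp measurable_snd
  unfold stepE; fun_prop

lemma measurable_stepU : Measurable fun z : (ℝ × ℝ) × (ℝ × ℝ) => stepU z.1 z.2 := by
  have := measurable_crossTime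
  unfold stepU; fun_prop

lemma measurable_transDens :
    Measurable fun z : ℝ × (ℝ × ℝ) × (ℝ × ℝ) => transDens z.1 z.2.1 z.2.2 := by
  have hc : Measurable fun z : ℝ × (ℝ × ℝ) × (ℝ × ℝ) => crossTime z.2.1 z.2.2 :=
    measurable_crossTime.comp measurable_snd
  unfold transDens
  refine Measurable.ite ?_ (by fun_prop) measurable_const
  have h1 : MeasurableSet {z : ℝ × (ℝ × ℝ) × (ℝ × ℝ) | 0 < z.2.2.1} :=
    measurableSet_lt measurable_const (by fun_prop)
  have h2 : MeasurableSet {z : ℝ × (ℝ × ℝ) × (ℝ × ℝ) | z.2.2.1 < z.2.1.1} :=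
    measurableSet_lt (by fun_prop) (by fun_prop)
  have h3 : MeasurableSet {z : ℝ × (ℝ × ℝ) × (ℝ × ℝ) | z.2.1.2 < z.2.2.2} :=
    measurableSet_lt (by fun_prop) (by fun_prop)
  have h4 : MeasurableSet {z : ℝ × (ℝ × ℝ) × (ℝ × ℝ) | crossTime z.2.1 z.2.2 < z.1} :=
    measurableSet_lt hc (by fun_prop)
  exact (h1.inter h2).inter (h3.inter h4)

lemma measurable_startDens : Measurable startDens :=
  Measurable.indicator (by fun_prop) isOpen_quadrant.measurableSet

/-- Under the transition density the step variables are independent, `E` is standard exponential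
and `U` is uniform. -/
lemma lintegral_transDens {s : ℝ} (hs : 0 < s) {p : ℝ × ℝ} (hp : 0 < p.1)
    {f : ℝ × ℝ → ℝ≥0∞} (hf : Measurable f) :
    ∫⁻ q, f (stepE s p q, stepU p q) * transDens s p q =
      ∫⁻ z, f z ∂((expMeasure 1).prod (volume.restrict (Icc 0 1))) := by
  have hprob : IsProbabilityMeasure (expMeasure 1) := isProbabilityMeasure_expMeasure one_pos
  obtain ⟨c, g⟩ := p
  simp only at hp
  have hmeas : Measurable fun q : ℝ × ℝ =>
      f (stepE s (c, g) q, stepU (c, g) q) * transDens s (c, g) q := by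
    refine (hf.comp (Measurable.prodMk ?_ ?_)).mul ?_
    · exact measurable_stepE.comp (g := fun z : ℝ × (ℝ × ℝ) × (ℝ × ℝ) => stepE z.1 z.2.1 z.2.2)
        (f := fun q => (s, (c, g), q)) (by fun_prop)
    · exact measurable_stepU.comp (g := fun z : (ℝ × ℝ) × (ℝ × ℝ) => stepU z.1 z.2)
        (f := fun q => ((c, g), q)) (by fun_prop)
    · exact measurable_transDens.comp
        (g := fun z : ℝ × (ℝ × ℝ) × (ℝ × ℝ) => transDens z.1 z.2.1 z.2.2)
        (f := fun q => (s, (c, g), q)) (by fun_prop)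
  rw [lintegral_prod_symm _ hf.aemeasurable, lintegral_Icc_eq_setLIntegral_Ioo hp,
    Measure.volume_eq_prod, lintegral_prod _ hmeas.aemeasurable,
    ← lintegral_indicator measurableSet_Ioo]
  refine lintegral_congr fun a => ?_
  by_cases ha : a ∈ Ioo 0 c
  swap
  · rw [indicator_of_notMem ha]
    refine (lintegral_congr fun y => ?_).trans lintegral_zero
    rw [transDens, if_neg (fun H => ha H.1), mul_zero]
  rw [indicator_of_mem ha]
  have hb : 0 < c - a := sub_pos.2 ha.2
  have hk : 0 < 4 * (c - a) / c ^ 2 := by positivity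
  -- for a given intercept the condition on the slope is `E > 0`, and `E` is affine in the slope
  have hind : ∀ y, f (stepE s (c, g) (a, y), stepU (c, g) (a, y)) * transDens s (c, g) (a, y) =
      (Ioi (g + (c - a) / s)).indicator (fun y =>
        f (c ^ 2 / 4 * ((y - g) / (c - a) - 1 / s), ((c - a) / c) ^ 2) *
        (2⁻¹ * ENNReal.ofReal (Real.exp (-(c ^ 2 / 4 * ((y - g) / (c - a) - 1 / s)))))) y := by
    intro y
    by_cases hy : y ∈ Ioi (g + (c - a) / s)
    · have hy' : (c - a) / s < y - g := by linarith [mem_Ioi.1 hy]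
      have hyg : 0 < y - g := (div_pos hb hs).trans hy'
      have hlt : (c - a) / (y - g) < s := by
        rw [div_lt_iff₀ hyg]; rwa [div_lt_iff₀ hs, mul_comm] at hy'
      rw [indicator_of_mem hy, transDens, if_pos ⟨ha, by simpa using hyg, hlt⟩]
      simp only [stepE, stepU, crossTime]
      rw [one_div_div, mul_div_cancel₀ _ hyg.ne']
    · rw [indicator_of_notMem hy, transDens, if_neg, mul_zero]
      rintro ⟨-, h1, h2⟩
      simp only [crossTime] at h1 h2
      have hyg : 0 < y - g := sub_pos.2 h1
      refine hy ?_
      rw [div_lt_iff₀ hyg] at h2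
      have : (c - a) / s < y - g := by rw [div_lt_iff₀ hs]; linarith
      rw [mem_Ioi]; linarith
  simp_rw [hind]
  rw [lintegral_indicator measurableSet_Ioi, setLIntegral_Ioi_affine hk]
  rw [lintegral_expMeasure_one (f := fun e => f (e, ((c - a) / c) ^ 2)) (hf.comp (by fun_prop))]
  have hE : ∀ e, c ^ 2 / 4 * ((g + (c - a) / s + 4 * (c - a) / c ^ 2 * e - g) / (c - a) - 1 / s)
      = e := by
    intro e; field_simp; ring
  simp_rw [hE]
  have h2 : ENNReal.ofReal (4 * (c - a) / c ^ 2) * 2⁻¹ = ENNReal.ofReal (2 * (c - a) / c ^ 2) := by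
    rw [show (2⁻¹ : ℝ≥0∞) = ENNReal.ofReal 2⁻¹ by
      rw [ENNReal.ofReal_inv_of_pos two_pos, ENNReal.ofReal_ofNat], ← ENNReal.ofReal_mul hk.le]
    congr 1; ring
  rw [← h2, mul_assoc]
  congr 1
  rw [← lintegral_const_mul' _ _ (by simp)]
  refine lintegral_congr fun e => ?_
  ring

/-- Under its density the first lead line yields the initial law. -/
lemma lintegral_startDens {f : ℝ × ℝ → ℝ≥0∞} (hf : Measurable f) :
    ∫⁻ p, f (p.1 + p.2, p.2) * startDens p = ∫⁻ z, f z ∂initialLaw := by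
  have hD : Measurable ({p : ℝ × ℝ | 0 < p.2 ∧ p.2 < p.1}.indicator
      fun p => ENNReal.ofReal (Real.exp (-p.1 ^ 2 / 4) / 2)) := by
    refine Measurable.indicator (by fun_prop) ?_
    exact (measurableSet_lt (f := fun _ : ℝ × ℝ => (0 : ℝ)) measurable_const measurable_snd).inter
      (measurableSet_lt measurable_snd measurable_fst)
  have hshear : MeasurePreserving (fun p : ℝ × ℝ => (p.1 + p.2, p.2)) volume volume := by
    have h : MeasurePreserving
        (Prod.swap ∘ (fun z : ℝ × ℝ => (z.1, z.1 + z.2)) ∘ Prod.swap) volume volume :=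
      (Measure.measurePreserving_swap (μ := (volume : Measure ℝ))
      (ν := (volume : Measure ℝ))).comp ((measurePreserving_prod_add (volume : Measure ℝ)
      (volume : Measure ℝ)).comp (Measure.measurePreserving_swap (μ := (volume : Measure ℝ))
      (ν := (volume : Measure ℝ))))
    have e : (fun p : ℝ × ℝ => (p.1 + p.2, p.2)) =
        Prod.swap ∘ (fun z : ℝ × ℝ => (z.1, z.1 + z.2)) ∘ Prod.swap := by
      funext p
      simp only [Function.comp_apply, Prod.swap, add_comm]
    rwa [e]
  rw [initialLaw, lintegral_withDensity_eq_lintegral_mul _ hD hf,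
    ← hshear.lintegral_comp (hD.mul hf)]
  refine lintegral_congr fun p => ?_
  rw [Pi.mul_apply, mul_comm, startDens]
  congr 1
  by_cases hp : p ∈ quadrant
  · have hp' := mem_quadrant.1 hp
    have hm : (p.1 + p.2, p.2) ∈ {p : ℝ × ℝ | 0 < p.2 ∧ p.2 < p.1} :=
      ⟨hp'.2, by simpa using hp'.1⟩
    rw [indicator_of_mem hp, indicator_of_mem hm,
      show Real.exp (-(p.1 + p.2) ^ 2 / 4) / 2 = 2⁻¹ * Real.exp (-((p.1 + p.2) ^ 2 / 4)) by
        rw [neg_div]; ring,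
      ENNReal.ofReal_mul (p := 2⁻¹) (by norm_num), ENNReal.ofReal_inv_of_pos two_pos,
      ENNReal.ofReal_ofNat]
  · rw [indicator_of_notMem hp, indicator_of_notMem]
    rintro ⟨h1, h2⟩
    exact hp (mem_quadrant.2 ⟨by simpa using h2, h1⟩)

lemma isProbabilityMeasure_initialLaw : IsProbabilityMeasure initialLaw := by
  constructor
  have hD : Measurable ({p : ℝ × ℝ | 0 < p.2 ∧ p.2 < p.1}.indicator
      fun p => ENNReal.ofReal (Real.exp (-p.1 ^ 2 / 4) / 2)) := by
    refine Measurable.indicator (by fun_prop) ?_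
    exact (measurableSet_lt (f := fun _ : ℝ × ℝ => (0 : ℝ)) measurable_const measurable_snd).inter
      (measurableSet_lt measurable_snd measurable_fst)
  rw [initialLaw, withDensity_apply _ MeasurableSet.univ, Measure.restrict_univ,
    Measure.volume_eq_prod, lintegral_prod _ hD.aemeasurable]
  have hinner : ∀ a : ℝ, ∫⁻ y, {p : ℝ × ℝ | 0 < p.2 ∧ p.2 < p.1}.indicator
      (fun p => ENNReal.ofReal (Real.exp (-p.1 ^ 2 / 4) / 2)) (a, y) =
      (Ioi 0).indicator (fun a => ENNReal.ofReal (a / 2 * Real.exp (-(a ^ 2 / 4)))) a := by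
    intro a
    have : ∀ y, {p : ℝ × ℝ | 0 < p.2 ∧ p.2 < p.1}.indicator
        (fun p => ENNReal.ofReal (Real.exp (-p.1 ^ 2 / 4) / 2)) (a, y) =
        (Ioo 0 a).indicator (fun _ => ENNReal.ofReal (Real.exp (-a ^ 2 / 4) / 2)) y := fun y => rfl
    simp_rw [this]
    rw [lintegral_indicator measurableSet_Ioo, setLIntegral_const, Real.volume_Ioo, sub_zero]
    by_cases ha : 0 < a
    · rw [indicator_of_mem (mem_Ioi.2 ha), ← ENNReal.ofReal_mul (by positivity)]
      congr 1; rw [neg_div]; ring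
    · rw [indicator_of_notMem (by simpa using ha), ENNReal.ofReal_of_nonpos (not_lt.1 ha), mul_zero]
  simp_rw [hinner]
  have hderiv : ∀ x ∈ Ici (0 : ℝ), HasDerivAt (fun a : ℝ => -Real.exp (-(a ^ 2 / 4)))
      (x / 2 * Real.exp (-(x ^ 2 / 4))) x := by
    intro x _
    have h1 : HasDerivAt (fun a : ℝ => -(a ^ 2 / 4)) (-(x / 2)) x := by
      have := (((hasDerivAt_id x).pow 2).div_const 4).neg
      refine this.congr_deriv ?_
      simp only [id_eq, Nat.cast_ofNat, Nat.add_one_sub_one, pow_one]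
      ring
    refine h1.exp.neg.congr_deriv ?_
    ring
  have hpos : ∀ x ∈ Ioi (0 : ℝ), 0 ≤ x / 2 * Real.exp (-(x ^ 2 / 4)) := fun x hx =>
    mul_nonneg (half_pos hx).le (Real.exp_nonneg _)
  have hlim : Tendsto (fun a : ℝ => -Real.exp (-(a ^ 2 / 4))) atTop (𝓝 0) := by
    rw [← neg_zero]
    refine (Real.tendsto_exp_atBot.comp (tendsto_neg_atTop_atBot.comp ?_)).neg
    exact (tendsto_pow_atTop two_ne_zero).atTop_div_const (by norm_num)
  rw [lintegral_indicator measurableSet_Ioi, ← ofReal_integral_eq_lintegral_ofReal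
    (integrableOn_Ioi_deriv_of_nonneg' hderiv hpos hlim)
    ((ae_restrict_mem measurableSet_Ioi).mono hpos),
    integral_Ioi_of_hasDerivAt_of_nonneg' hderiv hpos hlim]
  simp

/-! ### The joint law of the step variables -/

/-- The variables which parametrise a chain: height at time `1` and slope of the first line, and
then the step variables `(E, U)` one after the other. -/
noncomputable def chainParam (x : ℕ → ℝ × ℝ) : ℕ → ℝ × ℝ
  | 0 => ((x 0).1 + (x 0).2, (x 0).2)
  | i + 1 => (stepE (corner x i) (x i) (x (i + 1)), stepU (x i) (x (i + 1)))

/-- The laws of the variables `chainParam`. -/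
noncomputable def paramLaw : ℕ → Measure (ℝ × ℝ)
  | 0 => initialLaw
  | _ + 1 => (expMeasure 1).prod (volume.restrict (Icc 0 1))

instance isProbabilityMeasure_paramLaw (n : ℕ) : IsProbabilityMeasure (paramLaw n) := by
  cases n with
  | zero => exact isProbabilityMeasure_initialLaw
  | succ n =>
    have : IsProbabilityMeasure (expMeasure 1) := isProbabilityMeasure_expMeasure one_pos
    have : IsProbabilityMeasure (volume.restrict (Icc (0 : ℝ) 1)) := ⟨by simp⟩
    exact inferInstanceAs (IsProbabilityMeasure ((expMeasure 1).prod (volume.restrict (Icc 0 1))))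

section Congr

variable {x y : ℕ → ℝ × ℝ} {n : ℕ}

lemma corner_congr (h : ∀ i ≤ n, x i = y i) : corner x n = corner y n := by
  cases n with
  | zero => rfl
  | succ n => rw [corner, corner, h n (by omega), h (n + 1) le_rfl]

lemma chainParam_congr (h : ∀ i ≤ n, x i = y i) : chainParam x n = chainParam y n := by
  cases n with
  | zero => rw [chainParam, chainParam, h 0 le_rfl]
  | succ n =>
    rw [chainParam, chainParam, h n (by omega), h (n + 1) le_rfl,
      corner_congr fun i hi => h i (by omega)]

lemma chainDens_congr (h : ∀ i ≤ n, x i = y i) : chainDens x n = chainDens y n := by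
  induction n with
  | zero => rw [chainDens, chainDens, h 0 le_rfl]
  | succ n ih =>
    have h' : ∀ i ≤ n, x i = y i := fun i hi => h i (by omega)
    rw [chainDens, chainDens, ih h', corner_congr h', h n (by omega), h (n + 1) le_rfl]

end Congr

section Measurability

variable {α : Type*} [MeasurableSpace α] {x : α → ℕ → ℝ × ℝ}

lemma measurable_corner (hx : ∀ i, Measurable fun a => x a i) (n : ℕ) :
    Measurable fun a => corner (x a) n := by
  cases n with
  | zero => exact measurable_const
  | succ n => exact measurable_crossTime.comp ((hx n).prodMk (hx (n + 1)))

lemma measurable_chainParam (hx : ∀ i, Measurable fun a => x a i) (n : ℕ) :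
    Measurable fun a => chainParam (x a) n := by
  cases n with
  | zero => exact ((hx 0).fst.add (hx 0).snd).prodMk (hx 0).snd
  | succ n =>
    exact (measurable_stepE.comp ((measurable_corner hx n).prodMk
      ((hx n).prodMk (hx (n + 1))))).prodMk (measurable_stepU.comp ((hx n).prodMk (hx (n + 1))))

lemma measurable_chainDens (hx : ∀ i, Measurable fun a => x a i) (n : ℕ) :
    Measurable fun a => chainDens (x a) n := by
  induction n with
  | zero => exact measurable_startDens.comp (hx 0)
  | succ n ih =>
    exact ih.mul (measurable_transDens.comp ((measurable_corner hx n).prodMk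
      ((hx n).prodMk (hx (n + 1)))))

end Measurability

/-- Under the density `chainDens` the variables `chainParam` are independent with the laws
`paramLaw`. -/
lemma lintegral_chainDens (n : ℕ) (A : ℕ → Set (ℝ × ℝ)) (hA : ∀ i, MeasurableSet (A i)) :
    ∫⁻ x : Fin (n + 1) → ℝ × ℝ, (∏ i ∈ Finset.range (n + 1),
      (A i).indicator 1 (chainParam (extend x) i)) * chainDens (extend x) n =
    ∏ i ∈ Finset.range (n + 1), paramLaw i (A i) := by
  have hind : ∀ i, Measurable ((A i).indicator (1 : ℝ × ℝ → ℝ≥0∞)) := fun i =>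
    measurable_one.indicator (hA i)
  have hF : ∀ n, Measurable fun x : Fin (n + 1) → ℝ × ℝ => (∏ i ∈ Finset.range (n + 1),
      (A i).indicator (1 : ℝ × ℝ → ℝ≥0∞) (chainParam (extend x) i)) *
        chainDens (extend x) n := by
    intro n
    have hx : ∀ i, Measurable fun x : Fin (n + 1) → ℝ × ℝ => extend x i := fun i =>
      measurable_pi_apply _
    exact (Finset.measurable_fun_prod _ fun i _ =>
      (hind i).comp (measurable_chainParam hx i)).mul (measurable_chainDens hx n)
  induction n with
  | zero =>
    have h := (volume_preserving_funUnique (Fin 1) (ℝ × ℝ)).lintegral_comp_emb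
      (MeasurableEquiv.measurableEmbedding _)
      (fun p => (A 0).indicator 1 (p.1 + p.2, p.2) * startDens p)
    simp only [zero_add, Finset.range_one, Finset.prod_singleton, chainParam, chainDens]
    refine Eq.trans ?_ (h.trans ?_)
    · rfl
    · rw [lintegral_startDens (hind 0), lintegral_indicator_one (hA 0), paramLaw]
  | succ n ih =>
    have e := (volume_preserving_piFinSuccAbove (fun _ : Fin (n + 2) => ℝ × ℝ)
      (Fin.last (n + 1))).symm
    rw [← e.lintegral_comp (hF (n + 1)), Measure.volume_eq_prod, lintegral_prod_symm]
    swap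
    · exact ((hF (n + 1)).comp e.measurable).aemeasurable
    rw [Finset.prod_range_succ, ← ih, ← lintegral_mul_const _ (hF n)]
    refine lintegral_congr fun y => ?_
    have hlast : ∀ q, extend ((MeasurableEquiv.piFinSuccAbove (fun _ : Fin (n + 2) => ℝ × ℝ)
        (Fin.last (n + 1))).symm (q, y)) (n + 1) = q := by
      intro q
      refine (extend_apply _ (Fin.last (n + 1))).trans ?_
      exact Fin.insertNth_apply_same (α := fun _ : Fin (n + 2) => ℝ × ℝ) (Fin.last (n + 1)) q y
    have hinit : ∀ q, ∀ i ≤ n, extend ((MeasurableEquiv.piFinSuccAbove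
        (fun _ : Fin (n + 2) => ℝ × ℝ) (Fin.last (n + 1))).symm (q, y)) i = extend y i := by
      intro q i hi
      have h1 : i = (((⟨i, by omega⟩ : Fin (n + 1)).castSucc : Fin (n + 2)) : ℕ) := rfl
      have h2 : i = ((⟨i, by omega⟩ : Fin (n + 1)) : ℕ) := rfl
      conv_lhs => rw [h1, extend_apply]
      conv_rhs => rw [h2, extend_apply]
      have := Fin.insertNth_apply_succAbove (α := fun _ => ℝ × ℝ) (Fin.last (n + 1)) q y ⟨i, by omega⟩
      rwa [Fin.succAbove_last] at this
    have hprod : ∀ q, (∏ i ∈ Finset.range (n + 1 + 1), (A i).indicator (1 : ℝ × ℝ → ℝ≥0∞)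
        (chainParam (extend ((MeasurableEquiv.piFinSuccAbove (fun _ : Fin (n + 2) => ℝ × ℝ)
        (Fin.last (n + 1))).symm (q, y))) i)) * chainDens (extend
        ((MeasurableEquiv.piFinSuccAbove (fun _ : Fin (n + 2) => ℝ × ℝ)
        (Fin.last (n + 1))).symm (q, y))) (n + 1) =
        ((∏ i ∈ Finset.range (n + 1), (A i).indicator (1 : ℝ × ℝ → ℝ≥0∞)
          (chainParam (extend y) i)) * chainDens (extend y) n) *
        ((A (n + 1)).indicator 1 (stepE (corner (extend y) n) (extend y n) q,
          stepU (extend y n) q) * transDens (corner (extend y) n) (extend y n) q) := by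
      intro q
      rw [Finset.prod_range_succ, chainDens, chainParam, hlast, hinit q n le_rfl,
        chainDens_congr (hinit q), corner_congr (hinit q)]
      rw [Finset.prod_congr rfl fun i hi => by
        rw [chainParam_congr fun j hj => hinit q j
          (hj.trans (Nat.lt_succ_iff.1 (Finset.mem_range.1 hi)))]]
      ring
    simp only [hprod]
    have hstep : Measurable fun q : ℝ × ℝ => (A (n + 1)).indicator (1 : ℝ × ℝ → ℝ≥0∞)
        (stepE (corner (extend y) n) (extend y n) q, stepU (extend y n) q) *
        transDens (corner (extend y) n) (extend y n) q := by
      have hp : Measurable fun q : ℝ × ℝ => (corner (extend y) n, extend y n, q) := by fun_prop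
      exact ((hind _).comp ((measurable_stepE.comp hp).prodMk
        (measurable_stepU.comp (measurable_snd.comp hp)))).mul (measurable_transDens.comp hp)
    rw [lintegral_const_mul _ hstep]
    by_cases h0 : chainDens (extend y) n = 0
    · rw [h0, mul_zero, zero_mul, zero_mul]
    · have hc := isChain_of_chainDens_ne_zero h0
      rw [lintegral_transDens (hc.corner_pos n le_rfl) (mem_quadrant.1 (hc.mem n le_rfl)).1
        (hind _), lintegral_indicator_one (hA _), paramLaw]

/-! ### Independence from the finite-dimensional laws -/

section Independence

variable {Ω ι β : Type*} [MeasurableSpace Ω] [MeasurableSpace β] {μ : Measure Ω} {X : ι → Ω → β}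
  {ν : ι → Measure β} [∀ i, IsProbabilityMeasure (ν i)]

/-- If the product formula holds for a cofinal family of finite sets of indices and for all
measurable sets, then the variables are independent with the laws `ν i`. -/
lemma iIndepFun_of_cofinal (h : ∀ S : Finset ι, ∃ T, S ⊆ T ∧ ∀ A : ι → Set β,
      (∀ i, MeasurableSet (A i)) → μ (⋂ i ∈ T, X i ⁻¹' A i) = ∏ i ∈ T, ν i (A i)) :
    (∀ i A, MeasurableSet A → μ (X i ⁻¹' A) = ν i A) ∧ iIndepFun X μ := by
  classical
  have key : ∀ (S : Finset ι) (A : ι → Set β), (∀ i ∈ S, MeasurableSet (A i)) →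
      μ (⋂ i ∈ S, X i ⁻¹' A i) = ∏ i ∈ S, ν i (A i) := by
    intro S A hA
    obtain ⟨T, hST, hT⟩ := h S
    have := hT (fun i => if i ∈ S then A i else univ) fun i => by
      split_ifs with hi
      exacts [hA i hi, .univ]
    rw [← Finset.prod_subset hST fun i _ hi => by rw [if_neg hi, measure_univ],
      Finset.prod_congr rfl fun i hi => by rw [if_pos hi]] at this
    rw [← this]
    congr 1
    ext ω
    simp only [mem_iInter, mem_preimage]
    refine ⟨fun H i _ => ?_, fun H i hi => ?_⟩
    · split_ifs with hi
      exacts [H i hi, mem_univ _]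
    · have := H i (hST hi)
      rwa [if_pos hi] at this
  have law : ∀ i A, MeasurableSet A → μ (X i ⁻¹' A) = ν i A := fun i A hA => by
    simpa using key {i} (fun _ => A) fun _ _ => hA
  refine ⟨law, iIndepFun_iff_measure_inter_preimage_eq_mul.2 fun S A hA => ?_⟩
  rw [key S A hA]
  exact Finset.prod_congr rfl fun i hi => (law i _ (hA i hi)).symm

/-- The first of countably many independent variables is independent of the family of the
others. -/
lemma indepFun_zero_succ {X : ℕ → Ω → β} (hX : ∀ n, AEMeasurable (X n) μ)
    (h : iIndepFun X μ) : IndepFun (X 0) (fun ω n => X (n + 1) ω) μ := by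
  set Y : ℕ → Ω → β := fun n => (hX n).mk (X n) with hY
  have hYm : ∀ n, Measurable (Y n) := fun n => (hX n).measurable_mk
  have hXY : ∀ n, X n =ᵐ[μ] Y n := fun n => (hX n).ae_eq_mk
  have hi : iIndepFun Y μ := h.congr hXY
  have hd := indep_iSup_of_disjoint (fun n => (hYm n).comap_le) hi
    (S := {0}) (T := {n | 0 < n}) (by simp)
  have hY0 : IndepFun (Y 0) (fun ω n => Y (n + 1) ω) μ := by
    refine indep_of_indep_of_le_left (indep_of_indep_of_le_right hd ?_) ?_
    · rw [MeasurableSpace.pi, MeasurableSpace.comap_iSup]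
      refine iSup_le fun n => ?_
      rw [MeasurableSpace.comap_comp]
      exact le_biSup (fun k => MeasurableSpace.comap (Y k) inferInstance) (i := n + 1) n.succ_pos
    · simp
  refine hY0.congr (hXY 0).symm ?_
  filter_upwards [ae_all_iff.2 hXY] with ω hω
  funext n
  exact (hω (n + 1)).symm

end Independence

section

variable {Ω : Type*} [MeasurableSpace Ω] {μ : Measure Ω} {L : Ω → Set Line}

/-- The variables `chainParam` of the chain of all lead lines. -/
noncomputable def leadParam (L : Set Line) (n : ℕ) : ℝ × ℝ :=
  chainParam (fun i => coord (leadLine L i)) n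

lemma Regular.corner_leadLine {L : Set Line} (hL : Regular L) (n : ℕ) :
    corner (fun i => coord (leadLine L i)) n = changeTime L n := by
  cases n with
  | zero => rfl
  | succ n =>
    have h := (hL.isStep n).2.2
    have e := h.height_eq
    rw [Line.height_eq, (leadLine L (n + 1)).height_eq (changeTime L (n + 1))] at e
    have hne : (leadLine L (n + 1)).slope - (leadLine L n).slope ≠ 0 := (sub_pos.2 h.slope_lt).ne'
    simp only [corner, crossTime, coord_apply]
    rw [div_eq_iff hne]
    linarith

lemma leadParam_zero (L : Set Line) : leadParam L 0 = (seminal L 1, seminalSlope L 1) := by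
  simp only [leadParam, chainParam, coord_apply, leadLine_height, leadLine_slope, yIntercept,
    changeTime, one_mul, sub_add_cancel]

lemma chainParam_leadCoords {Ω : Type*} {L : Ω → Set Line} (n : ℕ) (ω : Ω) {i : ℕ} (hi : i ≤ n) :
    chainParam (extend (leadCoords L n ω)) i = leadParam (L ω) i := by
  refine chainParam_congr fun j hj => ?_
  have hj' : j = ((⟨j, by omega⟩ : Fin (n + 1)) : ℕ) := rfl
  conv_lhs => rw [hj', extend_apply]
  rfl

lemma aemeasurable_leadParam (hL : IsPoissonProcess L lineIntensity μ) (n : ℕ) :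
    AEMeasurable (fun ω => leadParam (L ω) n) μ := by
  have h : Measurable fun x : Fin (n + 1) → ℝ × ℝ => chainParam (extend x) n :=
    measurable_chainParam (fun i => measurable_pi_apply _) n
  refine (h.comp_aemeasurable (aemeasurable_leadCoords hL n)).congr (ae_of_all _ fun ω => ?_)
  exact chainParam_leadCoords n ω le_rfl

variable [IsProbabilityMeasure μ]

/-- The joint density of the first lead lines: the lower bound is attained, since it has total
mass `1`. -/
lemma map_leadCoords_eq (hL : IsPoissonProcess L lineIntensity μ) (n : ℕ) :
    μ.map (leadCoords L n) = volume.withDensity fun x => chainDens (extend x) n := by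
  have := Measure.isProbabilityMeasure_map (aemeasurable_leadCoords hL n)
  have hle := (withDensity_mono (ae_chainDens_le_rnDeriv hL n)).trans
    (Measure.withDensity_rnDeriv_le _ _)
  have := isFiniteMeasure_of_le _ hle
  refine (Measure.eq_of_le_of_measure_univ_eq hle ?_).symm
  · have := lintegral_chainDens n (fun _ => univ) fun _ => MeasurableSet.univ
    simp only [indicator_univ, Pi.one_apply, Finset.prod_const_one, one_mul, measure_univ] at this
    rw [withDensity_apply _ MeasurableSet.univ, Measure.restrict_univ, this, measure_univ]

lemma measure_leadParam (hL : IsPoissonProcess L lineIntensity μ) (n : ℕ)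
    (A : ℕ → Set (ℝ × ℝ)) (hA : ∀ i, MeasurableSet (A i)) :
    μ (⋂ i ∈ Finset.range (n + 1), (fun ω => leadParam (L ω) i) ⁻¹' A i) =
      ∏ i ∈ Finset.range (n + 1), paramLaw i (A i) := by
  have hx : ∀ i, Measurable fun x : Fin (n + 1) → ℝ × ℝ => extend x i := fun i =>
    measurable_pi_apply _
  have hB : MeasurableSet (⋂ i ∈ Finset.range (n + 1),
      (fun x : Fin (n + 1) → ℝ × ℝ => chainParam (extend x) i) ⁻¹' A i) :=
    Finset.measurableSet_biInter _ fun i _ => measurable_chainParam hx i (hA i)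
  have e : (⋂ i ∈ Finset.range (n + 1), (fun ω => leadParam (L ω) i) ⁻¹' A i) =
      leadCoords L n ⁻¹' (⋂ i ∈ Finset.range (n + 1),
        (fun x : Fin (n + 1) → ℝ × ℝ => chainParam (extend x) i) ⁻¹' A i) := by
    ext ω
    simp only [mem_iInter, mem_preimage, Finset.mem_range]
    refine forall₂_congr fun i hi => ?_
    rw [chainParam_leadCoords n ω (Nat.lt_succ_iff.1 hi)]
  rw [e, ← Measure.map_apply_of_aemeasurable (aemeasurable_leadCoords hL n) hB,
    map_leadCoords_eq hL n, withDensity_apply _ hB, ← lintegral_chainDens n A hA,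
    ← lintegral_indicator hB]
  refine lintegral_congr fun x => ?_
  by_cases hmem : x ∈ ⋂ i ∈ Finset.range (n + 1),
      (fun x : Fin (n + 1) → ℝ × ℝ => chainParam (extend x) i) ⁻¹' A i
  · rw [indicator_of_mem hmem, Finset.prod_eq_one, one_mul]
    intro i hi
    rw [indicator_of_mem (show chainParam (extend x) i ∈ A i from mem_iInter₂.1 hmem i hi),
      Pi.one_apply]
  · rw [indicator_of_notMem hmem]
    simp only [mem_iInter, not_forall] at hmem
    obtain ⟨i, hi, hni⟩ := hmem
    rw [Finset.prod_eq_zero hi 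
      (indicator_of_notMem (show chainParam (extend x) i ∉ A i from hni) _), zero_mul]

lemma leadParam_law (hL : IsPoissonProcess L lineIntensity μ) :
    (∀ i A, MeasurableSet A → μ ((fun ω => leadParam (L ω) i) ⁻¹' A) = paramLaw i A) ∧
      iIndepFun (fun i ω => leadParam (L ω) i) μ :=
  iIndepFun_of_cofinal fun S => ⟨Finset.range (S.sup id + 1),
    fun _ hi => Finset.mem_range.2 (Nat.lt_succ_of_le (Finset.le_sup (f := id) hi)),
    measure_leadParam hL _⟩

/-- The laws of the step variables `E` and `U`. -/
noncomputable def stepLaw : ℕ ⊕ ℕ → Measure ℝ :=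
  Sum.elim (fun _ => expMeasure 1) fun _ => volume.restrict (Icc 0 1)

instance isProbabilityMeasure_stepLaw (k : ℕ ⊕ ℕ) : IsProbabilityMeasure (stepLaw k) := by
  rcases k with k | k
  · exact isProbabilityMeasure_expMeasure one_pos
  · exact (⟨by simp⟩ : IsProbabilityMeasure (volume.restrict (Icc (0 : ℝ) 1)))

/-- The variables `E` and `U` of the steps between the lead lines. -/
noncomputable def leadStep (L : Set Line) : ℕ ⊕ ℕ → ℝ :=
  Sum.elim (fun n => (leadParam L (n + 1)).1) fun n => (leadParam L (n + 1)).2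

lemma leadStep_law (hL : IsPoissonProcess L lineIntensity μ) :
    (∀ k A, MeasurableSet A → μ ((fun ω => leadStep (L ω) k) ⁻¹' A) = stepLaw k A) ∧
      iIndepFun (fun k ω => leadStep (L ω) k) μ := by
  classical
  refine iIndepFun_of_cofinal fun S => ?_
  obtain ⟨N, hN⟩ : ∃ N : ℕ, S ⊆ (Finset.range N).disjSum (Finset.range N) := by
    refine ⟨S.sup (Sum.elim id id) + 1, fun k hk => ?_⟩
    have := Finset.le_sup (f := Sum.elim id id) hk
    rcases k with k | k
    · exact Finset.inl_mem_disjSum.2 (Finset.mem_range.2 (Nat.lt_succ_of_le this))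
    · exact Finset.inr_mem_disjSum.2 (Finset.mem_range.2 (Nat.lt_succ_of_le this))
  refine ⟨_, hN, fun A hA => ?_⟩
  set B : ℕ → Set (ℝ × ℝ) := fun n => n.casesOn univ fun n => A (.inl n) ×ˢ A (.inr n) with hB
  have hBm : ∀ n, MeasurableSet (B n) := by
    rintro (_ | n)
    · exact .univ
    · exact (hA _).prod (hA _)
  have h := measure_leadParam hL N B hBm
  have hN' : ∏ i ∈ Finset.range (N + 1), paramLaw i (B i) =
      ∏ k ∈ (Finset.range N).disjSum (Finset.range N), stepLaw k (A k) := by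
    rw [Finset.prod_range_succ', Finset.prod_disjSum, ← Finset.prod_mul_distrib]
    have h0 : paramLaw 0 (B 0) = 1 := measure_univ
    rw [h0, mul_one]
    refine Finset.prod_congr rfl fun i _ => ?_
    have : IsProbabilityMeasure (expMeasure 1) := isProbabilityMeasure_expMeasure one_pos
    exact Measure.prod_prod _ _
  rw [← hN', ← h]
  congr 1
  ext ω
  simp only [mem_iInter, mem_preimage]
  constructor
  · rintro H (_ | i) hi
    · exact mem_univ _
    · have hi' : i ∈ Finset.range N := Finset.mem_range.2 (by simpa using hi)
      exact ⟨H (.inl i) (Finset.inl_mem_disjSum.2 hi'), H (.inr i) (Finset.inr_mem_disjSum.2 hi')⟩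
  · rintro H (i | i) hi
    · have hi' : i + 1 ∈ Finset.range (N + 1) := by simpa using hi
      exact (H _ hi').1
    · have hi' : i + 1 ∈ Finset.range (N + 1) := by simpa using hi
      exact (H _ hi').2

/-- The recursion satisfied by the change times and the slopes. -/
lemma Regular.dynamics {L : Set Line} (hL : Regular L) (n : ℕ) :
    1 / changeTime L (n + 1) =
        1 / changeTime L n + 4 / yIntercept L n ^ 2 * leadStep L (.inl n) ∧
      seminalSlope L (changeTime L (n + 1)) = seminalSlope L (changeTime L n) +
        yIntercept L n / changeTime L (n + 1) * √(leadStep L (.inr n)) := by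
  have h := (hL.isStep n).2.2
  have hc : crossTime (coord (leadLine L n)) (coord (leadLine L (n + 1))) = changeTime L (n + 1) :=
    hL.corner_leadLine (n + 1)
  have hY : 0 < yIntercept L n := leadLine_height L n ▸ height_zero_pos h.lead.mem
  have hS := h.pos
  have hg := h.slope_lt
  constructor
  · simp only [leadStep, Sum.elim_inl, leadParam, chainParam, stepE]
    rw [hc, hL.corner_leadLine, coord_apply, leadLine_height]
    field_simp
    ring
  · have hpos : 0 ≤ ((leadLine L (n + 1)).slope - (leadLine L n).slope) *
        changeTime L (n + 1) / yIntercept L n :=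
      div_nonneg (mul_nonneg (sub_pos.2 hg).le hS.le) hY.le
    simp only [leadStep, Sum.elim_inr, leadParam, chainParam, stepU]
    rw [hc]
    simp only [coord_apply, leadLine_height]
    rw [Real.sqrt_sq hpos]
    simp only [leadLine_slope]
    field_simp
    ring

end

end PoissonCity

theorem theorem4p2 {Ω : Type*} [MeasurableSpace Ω] (μ : Measure Ω) [IsProbabilityMeasure μ]
    (L : Ω → Set Line) (hL : IsPoissonProcess L lineIntensity μ) :
    -- the successive slope-change times exhaust all changes of slope and decrease strictly
    (∀ᵐ ω ∂μ, changeTime (L ω) 0 = 1 ∧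
      (∀ n, changeTime (L ω) (n + 1) < changeTime (L ω) n) ∧
      (∀ n, 0 < changeTime (L ω) n) ∧
      slopeChanges (L ω) = range (fun n => changeTime (L ω) (n + 1))) ∧
    -- the tangent lines, their slopes and their intercepts on the `y` axis
    (∀ᵐ ω ∂μ, ∃ l : ℕ → Line, IsTangentEnumeration (L ω) l ∧
      (∀ n, ∀ s ∈ Ioc (changeTime (L ω) (n + 1)) (changeTime (L ω) n),
        HasDerivWithinAt (seminal (L ω)) (l n).slope (Iio s) s ∧
          seminalSlope (L ω) s = (l n).slope) ∧
      (∀ n, (l n).height 0 = yIntercept (L ω) n) ∧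
      (∀ n, 0 < yIntercept (L ω) n)) ∧
    -- the dynamics; `E n` and `U n` stand for the variables with index `n + 1`
    ∃ E U : ℕ → Ω → ℝ,
      (∀ᵐ ω ∂μ, ∀ n,
        1 / changeTime (L ω) (n + 1) =
          1 / changeTime (L ω) n + 4 / yIntercept (L ω) n ^ 2 * E n ω ∧
        seminalSlope (L ω) (changeTime (L ω) (n + 1)) =
          seminalSlope (L ω) (changeTime (L ω) n) +
            yIntercept (L ω) n / changeTime (L ω) (n + 1) * √(U n ω)) ∧
      (∀ n, HasLaw (E n) (expMeasure 1) μ) ∧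
      (∀ n, HasLaw (U n) (volume.restrict (Icc (0 : ℝ) 1)) μ) ∧
      iIndepFun (Sum.elim E U) μ ∧
      IndepFun (fun ω => (seminal (L ω) 1, seminalSlope (L ω) 1))
        (fun ω (k : ℕ ⊕ ℕ) => Sum.elim E U k ω) μ ∧
      HasLaw (fun ω => (seminal (L ω) 1, seminalSlope (L ω) 1)) initialLaw μ := by
  have hreg := ae_regular hL
  refine ⟨?_, ?_, fun n ω => leadStep (L ω) (.inl n), fun n ω => leadStep (L ω) (.inr n),
    ?_, ?_, ?_, ?_, ?_, ?_⟩
  · filter_upwards [hreg] with ω hω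
    exact ⟨rfl, fun n => (hω.isStep n).2.2.lt, fun n => (hω.isStep n).1, hω.slopeChanges_eq⟩
  · filter_upwards [hreg] with ω hω
    refine ⟨leadLine (L ω), hω.isTangentEnumeration, fun n s hs => ?_,
      leadLine_height (L ω), fun n => ?_⟩
    · have h := (hω.isStep n).2.2.eqOn
      exact ⟨hasDerivWithinAt_of_eqOn h hs, seminalSlope_of_eqOn h hs⟩
    · exact leadLine_height (L ω) n ▸ height_zero_pos (hω.isStep n).2.2.lead.mem
  · filter_upwards [hreg] with ω hω n using hω.dynamics n
  · intro n
    have hm : AEMeasurable (fun ω => leadStep (L ω) (.inl n)) μ :=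
      (aemeasurable_leadParam hL (n + 1)).fst
    refine ⟨hm, Measure.ext fun A hA => ?_⟩
    rw [Measure.map_apply_of_aemeasurable hm hA]
    exact (leadStep_law hL).1 (.inl n) A hA
  · intro n
    have hm : AEMeasurable (fun ω => leadStep (L ω) (.inr n)) μ :=
      (aemeasurable_leadParam hL (n + 1)).snd
    refine ⟨hm, Measure.ext fun A hA => ?_⟩
    rw [Measure.map_apply_of_aemeasurable hm hA]
    exact (leadStep_law hL).1 (.inr n) A hA
  · convert (leadStep_law hL).2 using 1
    funext k
    rcases k with k | k <;> rfl
  · have h := indepFun_zero_succ (aemeasurable_leadParam hL) (leadParam_law hL).2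
    have hφ : Measurable fun (z : ℕ → ℝ × ℝ) (k : ℕ ⊕ ℕ) =>
        (Sum.elim (fun n => (z n).1) (fun n => (z n).2) k : ℝ) := by
      refine measurable_pi_iff.2 ?_
      rintro (k | k)
      · exact (measurable_pi_apply k).fst
      · exact (measurable_pi_apply k).snd
    have h' := h.comp measurable_id hφ
    convert h' using 1
    · funext ω
      exact (leadParam_zero (L ω)).symm
    · funext ω k
      rcases k with k | k <;> rfl
  · have e : (fun ω => (seminal (L ω) 1, seminalSlope (L ω) 1)) = fun ω => leadParam (L ω) 0 :=
      funext fun ω => (leadParam_zero (L ω)).symm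
    rw [e]
    refine ⟨aemeasurable_leadParam hL 0, Measure.ext fun A hA => ?_⟩
    rw [Measure.map_apply_of_aemeasurable (aemeasurable_leadParam hL 0) hA]
    exact (leadParam_law hL).1 0 A hA
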